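/- Let $X$ be a compact smooth $(n+1)$-manifold ($n\ge 0$) with nonempty boundary, $f:X\to\mathbb R$ a smooth function with $df_x\neq 0$ at every $x\in\partial X$, and $v$ an $f$-gradient-like field: a smooth vector field that vanishes exactly on $Z=\{df=0\}$, satisfies $df(v)>0$ on $X\setminus Z$, and coincides in a neighborhood of $Z$ with the gradient of $f$ in some Riemannian metric on $X$. Let $X=Y_0\supset Y_1\supset\dots\supset Y_{n+1}$ be compact smooth submanifolds (possibly with boundary, possibly empty) of $X$, and let $S_j$ and $S_j^\partial$ be the critical sets of $f|_{Y_j}$ and $f|_{\partial Y_j}$. Assume: - $\dim Y_j=n+1-j$ for $0\le j\le n+1$; - $Y_1\subset\partial X$, and $Y_j\subset\partial Y_{j-1}$ is a regularly embedded submanifold for $2\le j\le n+1$; - for each $0\le j\le n+1$, all critical points of $f|_{Y_j}$ and of $f|_{\partial Y_j}$ are nondegenerate (Morse); - for each $1\le j\le n+1$ and every vector $\nu$ tangent to $Y_{j-1}$ at a point of $\partial Y_{j-1}$ and pointing strictly into $Y_{j-1}$: $df(\nu)>0$ if the point lies in $S_j$, and $df(\nu)<0$ if it lies in $S_{j-1}^\partial\setminus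 S_j$. For a vector field $u$ on $X$ put $\partial_0X(u)=\partial_0^+X(u)=X$, $\partial_1X(u)=\partial X$, and for $j\ge1$ let $\partial_{j+1}X(u)$ be the set of points of $\partial_jX(u)$ at which $u$ is tangent to $\partial_jX(u)$; for $j\ge 1$ let $\partial_j^+X(u)$ be the set of points of $\partial_jX(u)$ at which $u$ is directed inward of $\partial_{j-1}^+X(u)$ or is tangent to $\partial_jX(u)$. The field $u$ is called boundary generic if it is smooth, has no zeros on $\partial X$, is transversal to the zero section of $TX$, and for every $1\le j\le n+1$ the set $\partial_jX(u)$ is a smooth submanifold without boundary, of dimension $n+1-j$, and $u$, viewed as a section of the line bundle $T(\partial_{j-1}X(u))/T(\partial_jX(u))\to\partial_jX(u)$, is transversal to its zero section. Then there is a smooth family $\{v_t\}_{t\in[0,1]}$ of $f$-gradient-like fields with $v_0=v$ such that $\tilde v=v_1$ is boundary generic and $\partial_j^+X(\tilde v)=Y_j$ for all $0\le j\le n+1$. -/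

import Mathlib

open Set Filter Topology Manifold Bundle
open scoped ContDiff

noncomputable section

/-! ### Subsets of a manifold: velocities and tangent spaces -/

section Subsets

variable {E : Type*} [NormedAddCommGroup E] [NormedSpace ℝ E]
  {H : Type*} [TopologicalSpace H] (I : ModelWithCorners ℝ E H)
  {X : Type*} [TopologicalSpace X] [ChartedSpace H X]

/-- The velocities at `x` of the curves that start at `x` and stay in `S` for small times `t ≥ 0`.
For a smooth submanifold `S` this is the tangent space of `S` at an interior point of `S`, and the
closed half-space of the tangent vectors which are tangent to `∂S` or point into `S` at a point
of `∂S`. -/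
def tangentCone (S : Set X) (x : X) : Set (TangentSpace I x) :=
  {w | ∃ c : ℝ → X, c 0 = x ∧ (∀ᶠ t in 𝓝[≥] (0 : ℝ), c t ∈ S) ∧
    HasMFDerivWithinAt 𝓘(ℝ, ℝ) I c (Ici 0) 0 (ContinuousLinearMap.toSpanSingleton ℝ (w : E))}

/-- The tangent space at `x` of a submanifold `S`, as a subspace of the tangent space of `X`. -/
def tangentSub (S : Set X) (x : X) : Submodule ℝ (TangentSpace I x) :=
  Submodule.span ℝ (tangentCone I S x)

/-- The half-space `{u | 0 ≤ u₀}` of `ℝᵏ`; for `k = 0` it is the point `ℝ⁰`. -/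
def halfSpace (k : ℕ) : Set (EuclideanSpace ℝ (Fin k)) :=
  {u | ∀ i : Fin k, i.val = 0 → 0 ≤ u i}

/-- The edge `{u | u₀ = 0}` of the half-space of `ℝᵏ`; it is empty for `k = 0`. -/
def halfSpaceEdge (k : ℕ) : Set (EuclideanSpace ℝ (Fin k)) :=
  {u | ∃ i : Fin k, i.val = 0 ∧ u i = 0}

/-- `φ` and `ψ` are mutually inverse diffeomorphisms between a relatively open subset `W ∩ ℝᵏ₊` of
the half-space and the relatively open subset `S ∩ U` of `S`. As usual for subsets, smoothness on
`S ∩ U` means that `ψ` is the restriction of a smooth map of the open set `U`. -/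
structure IsLocalParam (k : ℕ) (S U : Set X) (W : Set (EuclideanSpace ℝ (Fin k)))
    (φ : EuclideanSpace ℝ (Fin k) → X) (ψ : X → EuclideanSpace ℝ (Fin k)) : Prop where
  isOpen_U : IsOpen U
  isOpen_W : IsOpen W
  smooth_φ : ContMDiffOn 𝓘(ℝ, EuclideanSpace ℝ (Fin k)) I ∞ φ (W ∩ halfSpace k)
  smooth_ψ : ContMDiffOn I 𝓘(ℝ, EuclideanSpace ℝ (Fin k)) ∞ ψ U
  mapsTo_φ : MapsTo φ (W ∩ halfSpace k) (S ∩ U)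
  mapsTo_ψ : MapsTo ψ (S ∩ U) (W ∩ halfSpace k)
  left_inv : LeftInvOn ψ φ (W ∩ halfSpace k)
  right_inv : LeftInvOn φ ψ (S ∩ U)

/-- `S` is a `k`-dimensional smooth embedded submanifold of `X`, possibly with boundary (no
condition is put on the position of `∂S` or of `S` with respect to `∂X`). -/
def IsSubmanifold (k : ℕ) (S : Set X) : Prop :=
  ∀ x ∈ S, ∃ U W φ ψ, IsLocalParam I k S U W φ ψ ∧ x ∈ U

/-- The boundary `∂S` of a `k`-dimensional submanifold `S`. -/
def subBoundary (k : ℕ) (S : Set X) : Set X :=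
  {x | x ∈ S ∧ ∃ U W φ ψ, IsLocalParam I k S U W φ ψ ∧ x ∈ U ∧ ψ x ∈ halfSpaceEdge k}

/-- The critical set of the restriction of `f` to a submanifold `S`. -/
def critSet (f : X → ℝ) (S : Set X) : Set X :=
  {x | x ∈ S ∧ ∀ w ∈ tangentSub I S x, mvfderiv I f x w = 0}

/-- The restriction of `f` to the `k`-dimensional submanifold `S` has only Morse-type critical
points: in every local parametrization the Hessian at a critical point is nondegenerate, that is,
the differential of the restriction is transversal to the zero section of `T*S`. -/
def IsMorseOn (k : ℕ) (f : X → ℝ) (S : Set X) : Prop :=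
  ∀ U W φ ψ, IsLocalParam I k S U W φ ψ → ∀ u ∈ W ∩ halfSpace k,
    fderivWithin ℝ (f ∘ φ) (halfSpace k) u = 0 →
    Function.Bijective
      (fderivWithin ℝ (fderivWithin ℝ (f ∘ φ) (halfSpace k)) (halfSpace k) u)

/-- `ν` points strictly into the `k`-dimensional submanifold `S` at the point `x` of `∂S`. -/
def PointsInto (k : ℕ) (S : Set X) (x : X) (ν : TangentSpace I x) : Prop :=
  ν ∈ tangentCone I S x ∧ ν ∉ tangentSub I (subBoundary I k S) x

/-! ### Vector fields -/

variable {I}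

/-- The vector field `v` on `X` is smooth. -/
def IsSmoothField (v : ∀ x : X, TangentSpace I x) [IsManifold I ∞ X] : Prop :=
  ContMDiff I I.tangent ∞ (fun x => (⟨x, v x⟩ : TangentBundle I X))

/-- `v` is a smooth gradient-like field of `f`: it has the same zeros `Z` as `df`, `df(v) > 0` off
`Z`, and near `Z` it is the gradient of `f` for some Riemannian metric on `X`. -/
structure IsGradientLike [IsManifold I ∞ X] (f : X → ℝ) (v : ∀ x : X, TangentSpace I x) :
    Prop where
  smooth : IsSmoothField v
  zero_iff : ∀ x, v x = 0 ↔ mvfderiv I f x = 0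
  pos : ∀ x, v x ≠ 0 → 0 < mvfderiv I f x (v x)
  gradient : ∃ (g : ContMDiffRiemannianMetric I ∞ E (fun x : X => TangentSpace I x)) (U : Set X),
    IsOpen U ∧ (∀ x, mvfderiv I f x = 0 → x ∈ U) ∧
    ∀ x ∈ U, ∀ w : TangentSpace I x, g.inner x (v x) w = mvfderiv I f x w

/-- The strata `∂ⱼX(v)`: `∂₀X = X`, `∂₁X = ∂X`, and `∂ⱼ₊₁X` is the locus of `∂ⱼX` where `v` is
tangent to `∂ⱼX`. -/
def morseStratum (v : ∀ x : X, TangentSpace I x) : ℕ → Set X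
  | 0 => univ
  | 1 => I.boundary X
  | j + 2 => {x | x ∈ morseStratum v (j + 1) ∧ v x ∈ tangentSub I (morseStratum v (j + 1)) x}

/-- The strata `∂ⱼ⁺X(v)`: `∂₀⁺X = X`, and `∂ⱼ₊₁⁺X` is the closed part of `∂ⱼ₊₁X = ∂(∂ⱼ⁺X)` where
`v` is directed inward of `∂ⱼ⁺X` (or is tangent to `∂ⱼ₊₁X`). -/
def morseStratumPlus (v : ∀ x : X, TangentSpace I x) : ℕ → Set X
  | 0 => univ
  | j + 1 => {x | x ∈ morseStratum v (j + 1) ∧ v x ∈ tangentCone I (morseStratumPlus v j) x}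

/-- As a section of the tangent bundle, `v` is transversal to the zero section: in a local
trivialization its derivative at each zero is bijective. -/
def TransversalToZero [IsManifold I ∞ X] (v : ∀ x : X, TangentSpace I x) : Prop :=
  ∀ x, v x = 0 → Function.Bijective
    (mvfderiv I (fun y => (trivializationAt E (TangentSpace I : X → Type _) x
      (⟨y, v y⟩ : TangentBundle I X)).2) x)

/-- Let `D ⊆ C` be submanifolds of consecutive dimensions and let `v` be tangent to `C` along `D`.
As a section of the line bundle `TC / TD` over `D`, the field `v` is transversal to the zero
section: at each zero `x` (a point of `D` where `v` is tangent to `D`) there is a local function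
`ρ` vanishing on `D` whose differential trivializes `TC / TD` near `x`, and the derivative at `x`,
along some vector of `TD`, of the section `dρ(v)` of the trivialized bundle is nonzero. -/
def NormalTransversal (C D : Set X) (v : ∀ x : X, TangentSpace I x) : Prop :=
  ∀ x ∈ D, v x ∈ tangentSub I D x →
    ∃ (U : Set X) (ρ : X → ℝ), IsOpen U ∧ x ∈ U ∧ ContMDiffOn I 𝓘(ℝ, ℝ) ∞ ρ U ∧
      (∀ y ∈ D ∩ U, ρ y = 0) ∧
      (∃ w ∈ tangentSub I C x, mvfderiv I ρ x w ≠ 0) ∧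
      ∃ w ∈ tangentSub I D x, mvfderiv I (fun y => mvfderiv I ρ y (v y)) x w ≠ 0

end Subsets

/-- Boundary generic fields on a manifold with boundary of dimension `n + 1`. -/
structure IsBoundaryGeneric {n : ℕ} {X : Type*} [TopologicalSpace X]
    [ChartedSpace (EuclideanHalfSpace (n + 1)) X] [IsManifold (𝓡∂ (n + 1)) ∞ X]
    (v : ∀ x : X, TangentSpace (𝓡∂ (n + 1)) x) : Prop where
  smooth : IsSmoothField v
  ne_zero : ∀ x ∈ (𝓡∂ (n + 1)).boundary X, v x ≠ 0
  transversal : TransversalToZero v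
  submanifold : ∀ j, 1 ≤ j → j ≤ n + 1 →
    IsSubmanifold (𝓡∂ (n + 1)) (n + 1 - j) (morseStratum v j) ∧
    subBoundary (𝓡∂ (n + 1)) (n + 1 - j) (morseStratum v j) = ∅
  normal_transversal : ∀ j, 1 ≤ j → j ≤ n + 1 →
    NormalTransversal (morseStratum v (j - 1)) (morseStratum v j) v

/-- A smooth deformation, within the space of `f`-gradient-like fields, of `v` into `v'`: a family
`V t`, `0 ≤ t ≤ 1`, of `f`-gradient-like fields which is jointly smooth in `t` and the point of
`X`, starts at `v` and ends at `v'`. -/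
def GradientLikeDeformation {E : Type*} [NormedAddCommGroup E] [NormedSpace ℝ E]
    {H : Type*} [TopologicalSpace H] {I : ModelWithCorners ℝ E H}
    {X : Type*} [TopologicalSpace X] [ChartedSpace H X] [IsManifold I ∞ X]
    (f : X → ℝ) (v v' : ∀ x : X, TangentSpace I x) : Prop :=
  ∃ V : ℝ → ∀ x : X, TangentSpace I x,
    ContMDiffOn (𝓘(ℝ, ℝ).prod I) I.tangent ∞
      (fun p : ℝ × X => (⟨p.2, V p.1 p.2⟩ : TangentBundle I X)) (Icc 0 1 ×ˢ univ) ∧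
    (∀ t ∈ Icc (0 : ℝ) 1, IsGradientLike f (V t)) ∧ V 0 = v ∧ V 1 = v'

end

/-!
# Prescribing the boundary strata of a gradient-like field

Each `Y j` is a closed codimension-zero piece of `C j`, where `C 0 = X` and `C (j + 1) = ∂ (Y j)`
(`boundaryStratum`). A partition of unity gives a smooth function `r j` on `X` such that within
`C j` one has `Y j = {0 ≤ r j}` and `∂ (Y j) = {r j = 0}`, with `dr_j` positive on vectors pointing
into `Y j` (`exists_isDefiningFunction`). Hence `C j` is the common zero set of
`r 0, …, r (j - 1)`, and along it these functions have independent differentials whose common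
kernel is the tangent space of `C j` (`IsDefiningTower.mem_tangentSub_stratum_iff`).

Suppose that a field `v'` satisfies `dr_j(v') = r_{j+1}` at every point of `∂ (Y j)`, for all `j`.
Then by induction `v'` is tangent to `∂ (Y j)` exactly where `r_{j+1} = 0`, that is along
`∂ (Y (j + 1))`, and it is directed into `Y j` exactly where `0 ≤ r_{j+1}`, that is along
`Y (j + 1)`. So the strata of `v'` are the `C j` and the `Y j`. The normal component of `v'`,
read through `dr_j`, is the function `r_{j+1}`, whose differential does not vanish on its zero set;
this is boundary genericity (`IsDefiningTower.morseStratumPlus_eq`,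
`IsDefiningTower.normalTransversal`).

The conditions `dr_j(v') = r_{j+1}` and `df(v') > 0` are convex at each point, so it suffices to
solve them locally. At a point of `∂ (Y p)` with `r_{p+1} ≠ 0` one needs a vector `w` tangent to
`C p` with `dr_p(w) = r_{p+1}` and `df(w) > 0`. If `df` does not vanish on the tangent space of
`∂ (Y p)`, a correction along that space produces one. Otherwise the point is critical for
`f|_{∂ (Y p)}`, and the sign of `df(w)` is dictated: the hypotheses on the critical points say
precisely that it is positive, both when `w` points into `Y p` (at a point of `Y (p + 1)`) and when
it points out of `Y p` (at the other points); see `IsDefiningTower.exists_vector`. The vector is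
extended to a local field with the prescribed derivatives, the local fields are patched, and `v`
is kept near the critical points of `f`, which lie off the boundary
(`IsDefiningTower.exists_adapted_field`).

Gradient-like fields that agree near the critical points of `f` form a convex set, so the linear
homotopy joins `v` to `v'` (`IsGradientLike.deformation`). Finally a gradient-like field is
transversal to the zero section because, at a zero, its derivative is the Hessian of the Morse
function `f` followed by the isomorphism given by the metric (`IsGradientLike.transversalToZero`).
-/

/-! ### Differentiation along curves in a subset -/

section Curves

variable {E : Type*} [NormedAddCommGroup E] [NormedSpace ℝ E]
  {H : Type*} [TopologicalSpace H] {I : ModelWithCorners ℝ E H}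
  {X : Type*} [TopologicalSpace X] [ChartedSpace H X]
  {F : Type*} [NormedAddCommGroup F] [NormedSpace ℝ F]

/-- Chain rule along a curve. -/
theorem hasDerivWithinAt_comp_curve {c : ℝ → X} {x : X} (hc0 : c 0 = x) {w : TangentSpace I x}
    (hc : HasMFDerivWithinAt 𝓘(ℝ, ℝ) I c (Ici 0) 0
      (ContinuousLinearMap.toSpanSingleton ℝ (w : E)))
    {g : X → F} (hg : MDifferentiableAt I 𝓘(ℝ, F) g x) :
    HasDerivWithinAt (g ∘ c) (mvfderiv I g x w) (Ici 0) 0 := by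
  subst hc0
  have h : HasFDerivWithinAt (g ∘ c) ((mvfderiv I g (c 0)).comp
      (ContinuousLinearMap.toSpanSingleton ℝ (w : E)) : ℝ →L[ℝ] F) (Ici 0) 0 :=
    (hg.hasMFDerivAt.comp_hasMFDerivWithinAt 0 hc).hasFDerivWithinAt
  have h2 := h.hasDerivWithinAt
  rwa [ContinuousLinearMap.comp_apply, ContinuousLinearMap.toSpanSingleton_apply, one_smul] at h2

theorem tendsto_curve {c : ℝ → X} {x : X} {S : Set X} (hc0 : c 0 = x) {w : TangentSpace I x}
    (hS : ∀ᶠ t in 𝓝[≥] (0 : ℝ), c t ∈ S)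
    (hc : HasMFDerivWithinAt 𝓘(ℝ, ℝ) I c (Ici 0) 0
      (ContinuousLinearMap.toSpanSingleton ℝ (w : E))) :
    Tendsto c (𝓝[≥] 0) (𝓝[S] x) := by
  rw [tendsto_nhdsWithin_iff]
  refine ⟨?_, hS⟩
  have := hc.continuousWithinAt
  rwa [ContinuousWithinAt, hc0] at this

theorem tangentCone_mono_of_eventually {S T : Set X} {x : X} (h : ∀ᶠ y in 𝓝[S] x, y ∈ T) :
    tangentCone I S x ⊆ tangentCone I T x := by
  rintro w ⟨c, hc0, hcS, hc⟩
  exact ⟨c, hc0, (tendsto_curve hc0 hcS hc).eventually h, hc⟩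

theorem tangentCone_mono {S T : Set X} {x : X} (h : S ⊆ T) :
    tangentCone I S x ⊆ tangentCone I T x :=
  tangentCone_mono_of_eventually (eventually_nhdsWithin_of_forall h)

/-- First order condition at a minimum of `g|_S`. -/
theorem mvfderiv_nonneg_of_mem_tangentCone {S : Set X} {x : X} {w : TangentSpace I x}
    (hw : w ∈ tangentCone I S x) {g : X → ℝ} (hg : MDifferentiableAt I 𝓘(ℝ, ℝ) g x)
    (hmin : ∀ᶠ y in 𝓝[S] x, g x ≤ g y) : 0 ≤ mvfderiv I g x w := by
  obtain ⟨c, hc0, hcS, hc⟩ := hw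
  have h := hasDerivWithinAt_comp_curve hc0 hc hg
  have h1 := (tendsto_curve hc0 hcS hc).eventually hmin
  rw [hasDerivWithinAt_iff_tendsto_slope] at h
  have h2 : Ici (0:ℝ) \ {0} = Ioi 0 := by ext; simp [lt_iff_le_and_ne, eq_comm]
  rw [h2] at h
  refine ge_of_tendsto h ?_
  filter_upwards [h1.filter_mono (nhdsWithin_mono _ Ioi_subset_Ici_self), self_mem_nhdsWithin]
    with t ht ht0
  rw [slope_def_field]
  simp only [Function.comp, hc0, sub_zero]
  exact div_nonneg (sub_nonneg.2 ht) (le_of_lt ht0)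

theorem mvfderiv_eq_zero_of_mem_tangentCone {S : Set X} {x : X} {w : TangentSpace I x}
    (hw : w ∈ tangentCone I S x) {g : X → F} (hg : MDifferentiableAt I 𝓘(ℝ, F) g x)
    (hconst : ∀ᶠ y in 𝓝[S] x, g y = g x) : mvfderiv I g x w = 0 := by
  obtain ⟨c, hc0, hcS, hc⟩ := hw
  have h := hasDerivWithinAt_comp_curve hc0 hc hg
  have h1 := (tendsto_curve hc0 hcS hc).eventually hconst
  have h2 : HasDerivWithinAt (g ∘ c) 0 (Ici 0) 0 := by
    refine (hasDerivWithinAt_const (0:ℝ) (Ici 0) (g x)).congr_of_eventuallyEq ?_ (by simp [hc0])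
    filter_upwards [h1] with t ht using ht
  exact (uniqueDiffOn_Ici (0:ℝ) 0 (by simp)).eq_deriv _ h h2

theorem mvfderiv_eq_zero_of_mem_tangentSub {S : Set X} {x : X} {w : TangentSpace I x}
    (hw : w ∈ tangentSub I S x) {g : X → F} (hg : MDifferentiableAt I 𝓘(ℝ, F) g x)
    (hconst : ∀ᶠ y in 𝓝[S] x, g y = g x) : mvfderiv I g x w = 0 := by
  have : tangentSub I S x ≤ LinearMap.ker (mvfderiv I g x).toLinearMap :=
    Submodule.span_le.2 fun w hw => mvfderiv_eq_zero_of_mem_tangentCone hw hg hconst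
  exact this hw

end Curves

/-! ### The half-space and local parametrizations -/

section HalfSpace

variable {k : ℕ}

theorem continuous_coord (i : Fin k) : Continuous fun u : EuclideanSpace ℝ (Fin k) => u i :=
  PiLp.continuous_apply 2 _ i

theorem isOpen_setOf_zero_lt (k : ℕ) :
    IsOpen {u : EuclideanSpace ℝ (Fin k) | ∀ i : Fin k, i.val = 0 → 0 < u i} := by
  simp only [ofPred_forall]
  exact isOpen_iInter_of_finite fun i => isOpen_iInter_of_finite fun _ =>
    isOpen_lt continuous_const (continuous_coord i)

theorem isClosed_halfSpaceEdge (k : ℕ) : IsClosed (halfSpaceEdge k) := by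
  have : halfSpaceEdge k = ⋃ i : Fin k, ⋃ _ : i.val = 0, {u | u i = 0} := by
    ext u; simp [halfSpaceEdge]
  rw [this]
  exact isClosed_iUnion_of_finite fun i => isClosed_iUnion_of_finite fun _ =>
    isClosed_eq (continuous_coord i) continuous_const

theorem pos_of_notMem_halfSpaceEdge {u : EuclideanSpace ℝ (Fin k)} (hu : u ∈ halfSpace k)
    (hu' : u ∉ halfSpaceEdge k) (i : Fin k) (hi : i.val = 0) : 0 < u i :=
  lt_of_le_of_ne (hu i hi) fun h => hu' ⟨i, hi, h.symm⟩

theorem neg_mem_halfSpace {u : EuclideanSpace ℝ (Fin k)} (hu : u ∉ halfSpace k) :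
    -u ∈ halfSpace k := by
  intro i hi
  obtain ⟨j, hj, hju⟩ : ∃ j : Fin k, j.val = 0 ∧ u j < 0 := by simpa [halfSpace] using hu
  rw [show i = j from Fin.ext (hi.trans hj.symm)]
  simpa using hju.le

theorem halfSpace_mem_nhds {u : EuclideanSpace ℝ (Fin k)} (hu : u ∈ halfSpace k)
    (hu' : u ∉ halfSpaceEdge k) : halfSpace k ∈ 𝓝 u :=
  mem_of_superset ((isOpen_setOf_zero_lt k).mem_nhds (pos_of_notMem_halfSpaceEdge hu hu'))
    fun _ hv i hi => (hv i hi).le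

theorem eq_zero_of_mem_halfSpaceEdge {u : EuclideanSpace ℝ (Fin k)} (hu : u ∈ halfSpaceEdge k)
    (i : Fin k) (hi : i.val = 0) : u i = 0 := by
  obtain ⟨j, hj, h⟩ := hu
  rwa [show i = j from Fin.ext (hi.trans hj.symm)]

/-- A ray from a point of the half-space stays in the half-space for small times, provided that its
direction is admissible when the point lies on the edge. -/
theorem eventually_ray_mem_halfSpace {u a : EuclideanSpace ℝ (Fin k)} (hu : u ∈ halfSpace k)
    (ha : u ∈ halfSpaceEdge k → a ∈ halfSpace k) :
    ∀ᶠ t in 𝓝[≥] (0 : ℝ), u + t • a ∈ halfSpace k := by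
  by_cases h : u ∈ halfSpaceEdge k
  · filter_upwards [self_mem_nhdsWithin] with t ht i hi
    have h1 := hu i hi
    have h2 := ha h i hi
    have h3 : (0:ℝ) ≤ t := ht
    simp only [PiLp.add_apply, PiLp.smul_apply, smul_eq_mul]
    positivity
  · have hc : Continuous fun t : ℝ => u + t • a := by fun_prop
    have : Tendsto (fun t : ℝ => u + t • a) (𝓝 0) (𝓝 u) := by
      simpa using hc.tendsto 0
    exact (this.eventually (halfSpace_mem_nhds hu h)).filter_mono nhdsWithin_le_nhds

end HalfSpace

section LocalParam

variable {E : Type*} [NormedAddCommGroup E] [NormedSpace ℝ E]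
  {H : Type*} [TopologicalSpace H] {I : ModelWithCorners ℝ E H}
  {X : Type*} [TopologicalSpace X] [ChartedSpace H X]
  {k : ℕ} {S U : Set X} {W : Set (EuclideanSpace ℝ (Fin k))}
  {φ : EuclideanSpace ℝ (Fin k) → X} {ψ : X → EuclideanSpace ℝ (Fin k)}

/-- Chain rule for the image under `φ` of a curve in a set within which `φ` is differentiable. -/
theorem hasMFDerivWithinAt_comp_curve {F : Type*} [NormedAddCommGroup F] [NormedSpace ℝ F]
    {φ : F → X} {s : Set F} {u : F} {D : F →L[ℝ] E}
    (hφ : HasMFDerivWithinAt 𝓘(ℝ, F) I φ s u D) {p : ℝ → F} {a : F}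
    (hp : HasDerivWithinAt p a (Ici 0) 0) (hp0 : p 0 = u) (hps : ∀ᶠ t in 𝓝[≥] (0 : ℝ), p t ∈ s) :
    HasMFDerivWithinAt 𝓘(ℝ, ℝ) I (φ ∘ p) (Ici 0) 0
      (ContinuousLinearMap.toSpanSingleton ℝ (D a)) := by
  subst hp0
  have hp' : HasMFDerivWithinAt 𝓘(ℝ, ℝ) 𝓘(ℝ, F) p (Ici 0 ∩ p ⁻¹' s) 0
      (ContinuousLinearMap.toSpanSingleton ℝ a) :=
    (hp.hasFDerivWithinAt.mono inter_subset_left).hasMFDerivWithinAt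
  have h := HasMFDerivWithinAt.comp 0 hφ hp' inter_subset_right
  have h2 := h.mono_of_mem_nhdsWithin (inter_mem self_mem_nhdsWithin hps)
  refine h2.congr_mfderiv ?_
  ext
  change D ((1 : ℝ) • a) = (1 : ℝ) • D a
  simp

namespace IsLocalParam

theorem contMDiffAt_ψ (h : IsLocalParam I k S U W φ ψ) {x : X} (hx : x ∈ U) :
    ContMDiffAt I 𝓘(ℝ, EuclideanSpace ℝ (Fin k)) ∞ ψ x :=
  (h.smooth_ψ x hx).contMDiffAt (h.isOpen_U.mem_nhds hx)

theorem mdifferentiableAt_ψ (h : IsLocalParam I k S U W φ ψ) {x : X} (hx : x ∈ U) :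
    MDifferentiableAt I 𝓘(ℝ, EuclideanSpace ℝ (Fin k)) ψ x :=
  (h.contMDiffAt_ψ hx).mdifferentiableAt (by simp)

theorem contMDiffWithinAt_φ (h : IsLocalParam I k S U W φ ψ) {u : EuclideanSpace ℝ (Fin k)}
    (hu : u ∈ W ∩ halfSpace k) :
    ContMDiffWithinAt 𝓘(ℝ, EuclideanSpace ℝ (Fin k)) I ∞ φ (halfSpace k) u :=
  (h.smooth_φ u hu).mono_of_mem_nhdsWithin
    (inter_mem (mem_nhdsWithin_of_mem_nhds (h.isOpen_W.mem_nhds hu.1)) self_mem_nhdsWithin)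

/-- Points of the parametrized set whose coordinates lie on the edge are boundary points. -/
theorem mem_subBoundary (h : IsLocalParam I k S U W φ ψ) {u : EuclideanSpace ℝ (Fin k)}
    (hu : u ∈ W ∩ halfSpace k) (hue : u ∈ halfSpaceEdge k) : φ u ∈ subBoundary I k S :=
  ⟨(h.mapsTo_φ hu).1, U, W, φ, ψ, h, (h.mapsTo_φ hu).2, by rwa [h.left_inv hu]⟩

/-- The differential `D` of a local parametrization at `x`: it is a right inverse of `dψ`, and it
identifies the half-space, or the whole space if `x` is not on the boundary, with the tangent
cone. -/
theorem exists_differential (h : IsLocalParam I k S U W φ ψ) {x : X} (hxS : x ∈ S) (hxU : x ∈ U) :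
    ∃ D : EuclideanSpace ℝ (Fin k) →L[ℝ] TangentSpace I x,
      HasMFDerivWithinAt 𝓘(ℝ, EuclideanSpace ℝ (Fin k)) I φ (halfSpace k) (ψ x) D ∧
      (∀ a, mvfderiv I ψ x (D a) = a) ∧
      (∀ a, (ψ x ∈ halfSpaceEdge k → a ∈ halfSpace k) → D a ∈ tangentCone I S x) ∧
      (∀ a, ψ x ∈ halfSpaceEdge k → (∀ i : Fin k, i.val = 0 → a i = 0) →
        D a ∈ tangentCone I (subBoundary I k S) x) ∧
      (∀ w ∈ tangentCone I S x, D (mvfderiv I ψ x w) = w ∧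
        (ψ x ∈ halfSpaceEdge k → mvfderiv I ψ x w ∈ halfSpace k)) := by
  have hu : ψ x ∈ W ∩ halfSpace k := h.mapsTo_ψ ⟨hxS, hxU⟩
  have hφx : φ (ψ x) = x := h.right_inv ⟨hxS, hxU⟩
  have hφ := ((h.contMDiffWithinAt_φ hu).mdifferentiableWithinAt (by simp)).hasMFDerivWithinAt
  obtain ⟨D, hD⟩ : ∃ D : EuclideanSpace ℝ (Fin k) →L[ℝ] E,
    HasMFDerivWithinAt 𝓘(ℝ, EuclideanSpace ℝ (Fin k)) I φ (halfSpace k) (ψ x) D := ⟨_, hφ⟩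
  have hray : ∀ a, (ψ x ∈ halfSpaceEdge k → a ∈ halfSpace k) →
      ∀ᶠ t in 𝓝[≥] (0 : ℝ), ψ x + t • a ∈ W ∩ halfSpace k := by
    intro a ha
    have hc : Continuous fun t : ℝ => ψ x + t • a := by fun_prop
    have : Tendsto (fun t : ℝ => ψ x + t • a) (𝓝 0) (𝓝 (ψ x)) := by simpa using hc.tendsto 0
    exact ((this.eventually (h.isOpen_W.mem_nhds hu.1)).filter_mono nhdsWithin_le_nhds).and
      (eventually_ray_mem_halfSpace hu.2 ha)
  have hcurve : ∀ a, (ψ x ∈ halfSpaceEdge k → a ∈ halfSpace k) →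
      HasMFDerivWithinAt 𝓘(ℝ, ℝ) I (fun t : ℝ => φ (ψ x + t • a)) (Ici 0) 0
        (ContinuousLinearMap.toSpanSingleton ℝ (D a : E)) := by
    intro a ha
    refine hasMFDerivWithinAt_comp_curve hD ?_ (by simp) ((hray a ha).mono fun t ht => ht.2)
    have := ((hasDerivAt_id (0:ℝ)).smul_const a).const_add (ψ x)
    simpa using this.hasDerivWithinAt
  have hψ := h.mdifferentiableAt_ψ hxU
  -- the chain rule for `ψ ∘ φ = id` along rays
  have hinv0 : ∀ a, (ψ x ∈ halfSpaceEdge k → a ∈ halfSpace k) →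
      mvfderiv I ψ x (D a) = a := by
    intro a ha
    have h1 := hasDerivWithinAt_comp_curve (x := x) (by simp [hφx]) (hcurve a ha) hψ
    have h2 : HasDerivWithinAt (fun t : ℝ => ψ x + t • a) a (Ici 0) 0 := by
      have := ((hasDerivAt_id (0:ℝ)).smul_const a).const_add (ψ x)
      simpa using this.hasDerivWithinAt
    have h3 : HasDerivWithinAt (ψ ∘ fun t : ℝ => φ (ψ x + t • a)) a (Ici 0) 0 := by
      refine h2.congr_of_eventuallyEq ?_ (by simp [hφx])
      filter_upwards [hray a ha] with t ht using h.left_inv ht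
    exact (uniqueDiffOn_Ici (0:ℝ) 0 (by simp)).eq_deriv _ h1 h3
  refine ⟨D, hD, fun a => ?_, fun a ha => ?_, fun a hxe ha => ?_, fun w hw => ?_⟩
  · by_cases ha : a ∈ halfSpace k
    · exact hinv0 a fun _ => ha
    · have hna : -a ∈ halfSpace k := neg_mem_halfSpace ha
      have h1 := hinv0 (-a) fun _ => hna
      rw [map_neg] at h1
      exact neg_injective ((map_neg (mvfderiv I ψ x) (D a)).symm.trans h1)
  · exact ⟨fun t => φ (ψ x + t • a), by simp [hφx],
      (hray a ha).mono fun t ht => (h.mapsTo_φ ht).1, hcurve a ha⟩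
  · have ha' : ψ x ∈ halfSpaceEdge k → a ∈ halfSpace k := fun _ i hi => (ha i hi).ge
    refine ⟨fun t => φ (ψ x + t • a), by simp [hφx], ?_, hcurve a ha'⟩
    filter_upwards [hray a ha'] with t ht
    obtain ⟨i, hi, hi0⟩ := hxe
    exact h.mem_subBoundary ht ⟨i, hi, by simp [hi0, ha i hi]⟩
  · obtain ⟨c, hc0, hcS, hc⟩ := id hw
    have h1 : HasDerivWithinAt (ψ ∘ c) (mvfderiv I ψ x w) (Ici 0) 0 :=
      hasDerivWithinAt_comp_curve hc0 hc hψ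
    have hcU : ∀ᶠ t in 𝓝[≥] (0 : ℝ), c t ∈ S ∩ U := hcS.and
      ((tendsto_curve hc0 hcS hc).eventually (mem_nhdsWithin_of_mem_nhds (h.isOpen_U.mem_nhds hxU)))
    constructor
    · have h2 := hasMFDerivWithinAt_comp_curve hD h1 (by simp [hc0])
        (hcU.mono fun t ht => (h.mapsTo_ψ ht).2)
      have h3 : HasMFDerivWithinAt 𝓘(ℝ, ℝ) I c (Ici 0) 0
          (ContinuousLinearMap.toSpanSingleton ℝ (D (mvfderiv I ψ x w))) := by
        refine h2.congr_of_eventuallyEq ?_ ?_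
        · filter_upwards [hcU] with t ht using (h.right_inv ht).symm
        · simp [hc0, hφx]
      have h4 := UniqueMDiffWithinAt.eq
        (uniqueDiffOn_Ici (0:ℝ) 0 (by simp)).uniqueMDiffWithinAt h3 hc
      have h5 := DFunLike.congr_fun h4 (1:ℝ)
      change (1:ℝ) • D (mvfderiv I ψ x w) = (1:ℝ) • w at h5
      exact (one_smul ℝ _).symm.trans (h5.trans (one_smul ℝ _))
    · intro hxe i hi
      have hg : MDifferentiableAt I 𝓘(ℝ, ℝ) (fun y => ψ y i) x :=
        (EuclideanSpace.proj (𝕜 := ℝ) i).mdifferentiableAt.comp x hψ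
      have h2 := hasDerivWithinAt_comp_curve hc0 hc hg
      have h3 : HasDerivWithinAt ((fun y => ψ y i) ∘ c) (mvfderiv I ψ x w i) (Ici 0) 0 :=
        (EuclideanSpace.proj (𝕜 := ℝ) i).hasFDerivAt.comp_hasDerivWithinAt 0 h1
      rw [← (uniqueDiffOn_Ici (0:ℝ) 0 (by simp)).eq_deriv _ h2 h3]
      refine mvfderiv_nonneg_of_mem_tangentCone hw hg ?_
      filter_upwards [inter_mem self_mem_nhdsWithin
        (mem_nhdsWithin_of_mem_nhds (h.isOpen_U.mem_nhds hxU))] with y hy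
      rw [eq_zero_of_mem_halfSpaceEdge hxe i hi]
      exact (h.mapsTo_ψ hy).2 i hi

end IsLocalParam

end LocalParam

/-! ### The boundary of a submanifold -/

section Boundary

variable {E : Type*} [NormedAddCommGroup E] [NormedSpace ℝ E]
  {H : Type*} [TopologicalSpace H] {I : ModelWithCorners ℝ E H}
  {X : Type*} [TopologicalSpace X] [ChartedSpace H X]
  {k : ℕ} {S U : Set X} {W : Set (EuclideanSpace ℝ (Fin k))}
  {φ : EuclideanSpace ℝ (Fin k) → X} {ψ : X → EuclideanSpace ℝ (Fin k)}

theorem mdifferentiableAt_coord {x : X}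
    (hψ : MDifferentiableAt I 𝓘(ℝ, EuclideanSpace ℝ (Fin k)) ψ x) (i : Fin k) :
    MDifferentiableAt I 𝓘(ℝ, ℝ) (fun y => ψ y i) x :=
  (EuclideanSpace.proj (𝕜 := ℝ) i).mdifferentiableAt.comp x hψ

theorem mvfderiv_coord {x : X}
    (hψ : MDifferentiableAt I 𝓘(ℝ, EuclideanSpace ℝ (Fin k)) ψ x) (i : Fin k)
    (w : TangentSpace I x) :
    mvfderiv I (fun y => ψ y i) x w = mvfderiv I ψ x w i := by
  have h := mfderiv_comp_apply x
    (EuclideanSpace.proj (𝕜 := ℝ) i).mdifferentiableAt hψ w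
  rw [ContinuousLinearMap.mfderiv_eq] at h
  exact h

namespace IsLocalParam

/-- Invariance of the boundary: if `x` had coordinates on the edge in one parametrization and off
the edge in another one, the tangent cone at `x` would be both a half-space and a whole space. -/
theorem mem_edge_of_mem_edge (h : IsLocalParam I k S U W φ ψ) {U' : Set X}
    {W' : Set (EuclideanSpace ℝ (Fin k))} {φ' : EuclideanSpace ℝ (Fin k) → X}
    {ψ' : X → EuclideanSpace ℝ (Fin k)} (h' : IsLocalParam I k S U' W' φ' ψ') {x : X} (hxS : x ∈ S)
    (hxU : x ∈ U) (hxU' : x ∈ U') (hx : ψ x ∈ halfSpaceEdge k) : ψ' x ∈ halfSpaceEdge k := by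
  by_contra hx'
  obtain ⟨i, hi, -⟩ := id hx
  obtain ⟨D, -, hD1, hD2, -, hD4⟩ := h.exists_differential hxS hxU
  obtain ⟨D', -, hD1', hD2', -, hD4'⟩ := h'.exists_differential hxS hxU'
  set e : EuclideanSpace ℝ (Fin k) := WithLp.toLp 2 fun _ => 1 with he
  have hw : D e ∈ tangentCone I S x := hD2 e fun _ j _ => by simp [he]
  have hw' : -(D e) ∈ tangentCone I S x := by
    have := hD2' (-(mvfderiv I ψ' x (D e))) fun h => absurd h hx'
    rwa [map_neg, (hD4' _ hw).1] at this
  have h1 := (hD4 _ hw').2 hx i hi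
  rw [map_neg, hD1] at h1
  simp [he] at h1
  linarith

theorem mem_subBoundary_iff (h : IsLocalParam I k S U W φ ψ) {x : X} (hxS : x ∈ S) (hxU : x ∈ U) :
    x ∈ subBoundary I k S ↔ ψ x ∈ halfSpaceEdge k := by
  refine ⟨?_, fun hx => ⟨hxS, U, W, φ, ψ, h, hxU, hx⟩⟩
  rintro ⟨-, U', W', φ', ψ', h', hxU', hx⟩
  exact h'.mem_edge_of_mem_edge h hxS hxU' hxU hx

theorem eventually_coord_eq_zero (h : IsLocalParam I k S U W φ ψ) {x : X} (hxU : x ∈ U)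
    {i : Fin k} (hi : i.val = 0) : ∀ᶠ y in 𝓝[subBoundary I k S] x, ψ y i = 0 := by
  filter_upwards [inter_mem self_mem_nhdsWithin
    (mem_nhdsWithin_of_mem_nhds (h.isOpen_U.mem_nhds hxU))] with y hy
  exact eq_zero_of_mem_halfSpaceEdge ((h.mem_subBoundary_iff hy.1.1 hy.2).1 hy.1) i hi

/-- A vector with vanishing first coordinate is tangent to the boundary, so the first coordinate of
a vector pointing strictly inside is nonzero. -/
theorem mvfderiv_coord_pos (h : IsLocalParam I k S U W φ ψ) {x : X} (hxU : x ∈ U)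
    (hx : x ∈ subBoundary I k S) {ν : TangentSpace I x} (hν : PointsInto I k S x ν) {i : Fin k}
    (hi : i.val = 0) : 0 < mvfderiv I ψ x ν i := by
  have hxe := (h.mem_subBoundary_iff hx.1 hxU).1 hx
  obtain ⟨D, -, hD1, hD2, hD3, hD4⟩ := h.exists_differential hx.1 hxU
  refine lt_of_le_of_ne ((hD4 ν hν.1).2 hxe i hi) fun h0 => hν.2 ?_
  rw [← (hD4 ν hν.1).1]
  refine Submodule.subset_span (hD3 _ hxe fun j hj => ?_)
  rw [show j = i from Fin.ext (hj.trans hi.symm), ← h0]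

/-- The converse of `mvfderiv_coord_pos`: the first coordinate vanishes on the boundary, hence its
differential vanishes on the tangent space of the boundary. -/
theorem pointsInto (h : IsLocalParam I k S U W φ ψ) {x : X} (hxU : x ∈ U)
    (hx : x ∈ subBoundary I k S) {ν : TangentSpace I x} (hν : ν ∈ tangentCone I S x) {i : Fin k}
    (hi : i.val = 0) (hpos : 0 < mvfderiv I ψ x ν i) : PointsInto I k S x ν := by
  refine ⟨hν, fun hmem => hpos.ne' ?_⟩
  have hψ := h.mdifferentiableAt_ψ hxU
  have hxe := (h.mem_subBoundary_iff hx.1 hxU).1 hx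
  rw [← mvfderiv_coord hψ]
  refine mvfderiv_eq_zero_of_mem_tangentSub hmem (mdifferentiableAt_coord hψ i) ?_
  rw [eq_zero_of_mem_halfSpaceEdge hxe i hi]
  exact h.eventually_coord_eq_zero hxU hi

end IsLocalParam

/-- At each boundary point of a submanifold some tangent vector points strictly inside. -/
theorem exists_pointsInto {x : X} (hx : x ∈ subBoundary I k S) :
    ∃ ν : TangentSpace I x, PointsInto I k S x ν := by
  obtain ⟨hxS, U, W, φ, ψ, h, hxU, hxe⟩ := id hx
  obtain ⟨D, -, hD1, hD2, -, -⟩ := h.exists_differential hxS hxU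
  obtain ⟨i, hi, -⟩ := id hxe
  set e : EuclideanSpace ℝ (Fin k) := WithLp.toLp 2 fun _ => 1 with he
  exact ⟨D e, h.pointsInto hxU hx (hD2 e fun _ j _ => by simp [he]) hi (by simp [hD1, he])⟩

theorem isClosed_subBoundary (hS : IsClosed S) (hSm : IsSubmanifold I k S) :
    IsClosed (subBoundary I k S) := by
  rw [← isOpen_compl_iff, isOpen_iff_mem_nhds]
  intro x hx
  by_cases hxS : x ∈ S
  · obtain ⟨U, W, φ, ψ, h, hxU⟩ := hSm x hxS
    have hxe : ψ x ∉ halfSpaceEdge k := fun he => hx ((h.mem_subBoundary_iff hxS hxU).2 he)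
    have h1 := (h.contMDiffAt_ψ hxU).continuousAt.eventually
      ((isClosed_halfSpaceEdge k).isOpen_compl.mem_nhds hxe)
    filter_upwards [h1, h.isOpen_U.mem_nhds hxU] with y hy hyU hyb
    exact hy ((h.mem_subBoundary_iff hyb.1 hyU).1 hyb)
  · filter_upwards [hS.isOpen_compl.mem_nhds hxS] with y hy hyb using hy hyb.1

/-- Near each of its points the boundary of a `k`-dimensional submanifold has a parametrization by
an open subset of `ℝᵏ⁻¹`, which may be taken off the edge of the half-space. -/
theorem exists_isLocalParam_subBoundary {x : X} (hx : x ∈ subBoundary I k S) :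
    ∃ U W φ ψ, IsLocalParam I (k - 1) (subBoundary I k S) U W φ ψ ∧ x ∈ U ∧
      ∀ u ∈ W, ∀ i : Fin (k - 1), i.val = 0 → 0 < u i := by
  obtain ⟨hxS, U, W, φ, ψ, h, hxU, hxe⟩ := id hx
  obtain _ | m := k
  · obtain ⟨i, -⟩ := hxe; exact i.elim0
  change ∃ (U : Set X) (W : Set (EuclideanSpace ℝ (Fin m))) (φ : EuclideanSpace ℝ (Fin m) → X)
    (ψ : X → EuclideanSpace ℝ (Fin m)), IsLocalParam I m (subBoundary I (m + 1) S) U W φ ψ ∧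
      x ∈ U ∧ ∀ u ∈ W, ∀ i : Fin m, i.val = 0 → 0 < u i
  set tail : EuclideanSpace ℝ (Fin (m + 1)) → EuclideanSpace ℝ (Fin m) :=
    fun u => WithLp.toLp 2 fun i => u i.succ with htail
  set cons : EuclideanSpace ℝ (Fin m) → EuclideanSpace ℝ (Fin (m + 1)) :=
    fun u => WithLp.toLp 2 (Fin.cons 0 u) with hcons
  have htc : ∀ u, tail (cons u) = u := fun u => by ext i; simp [htail, hcons]
  have hct : ∀ u ∈ halfSpaceEdge (m + 1), cons (tail u) = u := by
    intro u hu
    ext i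
    refine Fin.cases ?_ (fun i => ?_) i
    · simp [hcons, eq_zero_of_mem_halfSpaceEdge hu 0 rfl]
    · simp [htail, hcons]
  have hcons_edge : ∀ u, cons u ∈ halfSpaceEdge (m + 1) := fun u => ⟨0, rfl, by simp [hcons]⟩
  have hcons_half : ∀ u, cons u ∈ halfSpace (m + 1) := by
    intro u i hi
    rw [eq_zero_of_mem_halfSpaceEdge (hcons_edge u) i hi]
  have htail_smooth : ContDiff ℝ ∞ tail := by
    rw [contDiff_euclidean]
    intro i
    simp only [htail]
    exact contDiff_euclidean.1 contDiff_id i.succ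
  have hcons_smooth : ContDiff ℝ ∞ cons := by
    rw [contDiff_euclidean]
    intro i
    refine Fin.cases ?_ (fun i => ?_) i
    · simp only [hcons, Fin.cons_zero]; exact contDiff_const
    · simp only [hcons, Fin.cons_succ]
      exact contDiff_euclidean.1 contDiff_id i
  -- the translation moves the coordinates of `x` to the point `(2, …, 2)`
  set c : EuclideanSpace ℝ (Fin m) := (WithLp.toLp 2 fun _ => 2) - tail (ψ x) with hc
  set P : Set (EuclideanSpace ℝ (Fin m)) := {u | ∀ i : Fin m, i.val = 0 → 0 < u i} with hP
  have hPo : IsOpen P := isOpen_setOf_zero_lt m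
  have hPh : P ⊆ halfSpace m := fun u hu i hi => (hu i hi).le
  have hψ' : ContMDiffOn I 𝓘(ℝ, EuclideanSpace ℝ (Fin m)) ∞ (fun y => tail (ψ y) + c) U :=
    (htail_smooth.add contDiff_const).contMDiff.comp_contMDiffOn h.smooth_ψ
  have hshift : ContDiff ℝ ∞ fun u => cons (u - c) :=
    hcons_smooth.comp (contDiff_id.sub contDiff_const)
  have hmem : ∀ y ∈ subBoundary I (m + 1) S, y ∈ U → ψ y ∈ halfSpaceEdge (m + 1) :=
    fun y hy hyU => (h.mem_subBoundary_iff hy.1 hyU).1 hy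
  refine ⟨U ∩ (fun y => tail (ψ y) + c) ⁻¹' P, (fun u => cons (u - c)) ⁻¹' W ∩ P,
    fun u => φ (cons (u - c)), fun y => tail (ψ y) + c, ?_, ⟨hxU, ?_⟩, fun u hu => hu.2⟩
  · constructor
    · exact hψ'.continuousOn.isOpen_inter_preimage h.isOpen_U hPo
    · exact (h.isOpen_W.preimage hshift.continuous).inter hPo
    · exact h.smooth_φ.comp hshift.contMDiff.contMDiffOn fun u hu => ⟨hu.1.1, hcons_half _⟩
    · exact hψ'.mono inter_subset_left
    · intro u hu
      have hu' : cons (u - c) ∈ W ∩ halfSpace (m + 1) := ⟨hu.1.1, hcons_half _⟩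
      refine ⟨h.mem_subBoundary hu' (hcons_edge _), (h.mapsTo_φ hu').2, ?_⟩
      simp only [mem_preimage, h.left_inv hu', htc, sub_add_cancel]
      exact hu.1.2
    · intro y hy
      refine ⟨⟨?_, hy.2.2⟩, hPh hy.2.2⟩
      simp only [mem_preimage, add_sub_cancel_right, hct _ (hmem y hy.1 hy.2.1)]
      exact (h.mapsTo_ψ ⟨hy.1.1, hy.2.1⟩).1
    · intro u hu
      have hu' : cons (u - c) ∈ W ∩ halfSpace (m + 1) := ⟨hu.1.1, hcons_half _⟩
      simp only [h.left_inv hu', htc, sub_add_cancel]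
    · intro y hy
      simp only [add_sub_cancel_right, hct _ (hmem y hy.1 hy.2.1)]
      exact h.right_inv ⟨hy.1.1, hy.2.1⟩
  · intro i _
    simp [hc]

theorem isSubmanifold_subBoundary : IsSubmanifold I (k - 1) (subBoundary I k S) := fun _ hx =>
  let ⟨U, W, φ, ψ, h, hxU, _⟩ := exists_isLocalParam_subBoundary hx
  ⟨U, W, φ, ψ, h, hxU⟩

theorem subBoundary_subBoundary : subBoundary I (k - 1) (subBoundary I k S) = ∅ := by
  refine eq_empty_of_forall_notMem fun x hx => ?_
  obtain ⟨U, W, φ, ψ, h, hxU, hW⟩ := exists_isLocalParam_subBoundary hx.1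
  obtain ⟨i, hi, h0⟩ := (h.mem_subBoundary_iff hx.1 hxU).1 hx
  exact (hW _ (h.mapsTo_ψ ⟨hx.1, hxU⟩).1 i hi).ne' h0

/-- Let `S ⊆ C` be submanifolds of the same dimension, where `C` has no boundary. Near a point of
`S`, the set `S` consists of the points of `C` at which the coordinates of `S` take values in the
half-space: these coordinates restrict to a local diffeomorphism of `C`. -/
theorem IsLocalParam.eventually_mem_of_subset (h : IsLocalParam I k S U W φ ψ) {C U' : Set X}
    {W' : Set (EuclideanSpace ℝ (Fin k))} {φ' : EuclideanSpace ℝ (Fin k) → X}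
    {ψ' : X → EuclideanSpace ℝ (Fin k)} (h' : IsLocalParam I k C U' W' φ' ψ')
    (hW' : ∀ u ∈ W', ∀ i : Fin k, i.val = 0 → 0 < u i) (hSC : S ⊆ C) {x : X} (hxS : x ∈ S)
    (hxU : x ∈ U) (hxU' : x ∈ U') : ∀ᶠ y in 𝓝[C] x, ψ y ∈ halfSpace k → y ∈ S := by
  have hW'h : W' ⊆ halfSpace k := fun u hu i hi => (hW' u hu i hi).le
  have hu' := h'.mapsTo_ψ ⟨hSC hxS, hxU'⟩
  have hu := h.mapsTo_ψ ⟨hxS, hxU⟩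
  have hφ'x : φ' (ψ' x) = x := h'.right_inv ⟨hSC hxS, hxU'⟩
  have hφx : φ (ψ x) = x := h.right_inv ⟨hxS, hxU⟩
  have hnhds : halfSpace k ∈ 𝓝 (ψ' x) := mem_of_superset (h'.isOpen_W.mem_nhds hu'.1) hW'h
  have hφ' : ContMDiffAt 𝓘(ℝ, EuclideanSpace ℝ (Fin k)) I ∞ φ' (ψ' x) :=
    (h'.contMDiffWithinAt_φ hu').contMDiffAt hnhds
  -- `ψ ∘ φ'` has an invertible differential, so it is injective near `ψ' x`
  obtain ⟨V, hV, hinj⟩ : ∃ V ∈ 𝓝 (ψ' x), InjOn (ψ ∘ φ') V := by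
    have hτ : ContDiffAt ℝ ∞ (ψ ∘ φ') (ψ' x) := by
      refine ContMDiffAt.contDiffAt (ContMDiffAt.comp _ ?_ hφ')
      rw [hφ'x]; exact h.contMDiffAt_ψ hxU
    have hstrict := hτ.hasStrictFDerivAt (by simp)
    obtain ⟨D, -, hD1, hD2, -, -⟩ := h.exists_differential hxS hxU
    obtain ⟨D', hD', -, -, -, hD4'⟩ := h'.exists_differential (hSC hxS) hxU'
    have hτ' : ∀ a, fderiv ℝ (ψ ∘ φ') (ψ' x) a = mvfderiv I ψ x (D' a) := by
      intro a
      have hp : HasDerivWithinAt (fun t : ℝ => ψ' x + t • a) a (Ici 0) 0 := by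
        have := ((hasDerivAt_id (0:ℝ)).smul_const a).const_add (ψ' x)
        simpa using this.hasDerivWithinAt
      have hps : ∀ᶠ t in 𝓝[≥] (0 : ℝ), ψ' x + t • a ∈ halfSpace k := by
        have := hp.continuousWithinAt
        rw [ContinuousWithinAt, zero_smul, add_zero] at this
        exact this.eventually hnhds
      have h1 := hasDerivWithinAt_comp_curve (x := x) (by simp [hφ'x])
        (hasMFDerivWithinAt_comp_curve hD' hp (by simp) hps) (h.mdifferentiableAt_ψ hxU)
      have hd : HasFDerivAt (ψ ∘ φ') (fderiv ℝ (ψ ∘ φ') (ψ' x)) (ψ' x + (0:ℝ) • a) := by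
        simpa using hstrict.hasFDerivAt
      exact (uniqueDiffOn_Ici (0:ℝ) 0 (by simp)).eq_deriv _
        (hd.comp_hasDerivWithinAt (0:ℝ) hp) h1
    have hhalf : ∀ b ∈ halfSpace k, ∃ a, fderiv ℝ (ψ ∘ φ') (ψ' x) a = b := by
      intro b hb
      refine ⟨mvfderiv I ψ' x (D b), ?_⟩
      rw [hτ', (hD4' _ (tangentCone_mono hSC (hD2 b fun _ => hb))).1, hD1]
    have hsurj : Function.Surjective (fderiv ℝ (ψ ∘ φ') (ψ' x)).toLinearMap := by
      intro b
      by_cases hb : b ∈ halfSpace k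
      · exact hhalf b hb
      · obtain ⟨a, ha⟩ := hhalf (-b) (neg_mem_halfSpace hb)
        exact ⟨-a, by simp [ha]⟩
    set L := (LinearEquiv.ofBijective (fderiv ℝ (ψ ∘ φ') (ψ' x)).toLinearMap
      ⟨LinearMap.injective_iff_surjective.2 hsurj, hsurj⟩).toContinuousLinearEquiv with hL
    have hstrict' : HasStrictFDerivAt (ψ ∘ φ')
        (L : EuclideanSpace ℝ (Fin k) →L[ℝ] EuclideanSpace ℝ (Fin k)) (ψ' x) := by
      convert! hstrict using 1
    refine ⟨(hstrict'.toOpenPartialHomeomorph _).source,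
      (hstrict'.toOpenPartialHomeomorph _).open_source.mem_nhds
        hstrict'.mem_toOpenPartialHomeomorph_source, ?_⟩
    simpa using (hstrict'.toOpenPartialHomeomorph _).injOn
  have hψ'c := (h'.contMDiffAt_ψ hxU').continuousAt
  have hψc := (h.contMDiffAt_ψ hxU).continuousAt
  have hφc : Tendsto φ (𝓝[halfSpace k] (ψ x)) (𝓝 x) := by
    have := (h.contMDiffWithinAt_φ hu).continuousWithinAt
    rwa [ContinuousWithinAt, hφx] at this
  have h1 := hφc.eventually ((h'.isOpen_U.eventually_mem hxU').and (hψ'c.eventually hV))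
  have h2 := hψc.eventually (eventually_nhdsWithin_iff.1 h1)
  filter_upwards [self_mem_nhdsWithin, h2.filter_mono nhdsWithin_le_nhds,
    (hψc.eventually (h.isOpen_W.mem_nhds hu.1)).filter_mono nhdsWithin_le_nhds,
    (hψ'c.eventually hV).filter_mono nhdsWithin_le_nhds,
    (h'.isOpen_U.eventually_mem hxU').filter_mono nhdsWithin_le_nhds]
    with y hyC hy hyW hyV hyU' hyh
  obtain ⟨hzU', hzV⟩ := hy hyh
  have hz := h.mapsTo_φ ⟨hyW, hyh⟩
  have h3 : ψ' (φ (ψ y)) = ψ' y := by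
    refine hinj hzV hyV ?_
    simp only [Function.comp]
    rw [h'.right_inv ⟨hSC hz.1, hzU'⟩, h'.right_inv ⟨hyC, hyU'⟩, h.left_inv ⟨hyW, hyh⟩]
  have h4 : φ (ψ y) = y := by
    rw [← h'.right_inv ⟨hSC hz.1, hzU'⟩, h3, h'.right_inv ⟨hyC, hyU'⟩]
  exact h4 ▸ hz.1

end Boundary

/-! ### Defining functions of a submanifold with boundary -/

section DefiningFunction

variable {E : Type*} [NormedAddCommGroup E] [NormedSpace ℝ E]
  {H : Type*} [TopologicalSpace H] {I : ModelWithCorners ℝ E H}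
  {X : Type*} [TopologicalSpace X] [ChartedSpace H X]
  {k : ℕ} {C S : Set X}

variable (I) in
/-- A smooth function `r` on `X` defines the `k`-dimensional submanifold with boundary `S` inside
the set `C`: within `C`, the set `S` is `{0 ≤ r}`, its boundary is `{r = 0}`, and `dr` is positive
on the vectors which point strictly into `S`. -/
structure IsDefiningFunction (k : ℕ) (C S : Set X) (r : X → ℝ) : Prop where
  smooth : ContMDiff I 𝓘(ℝ, ℝ) ∞ r
  nonneg_iff : ∀ x ∈ C, 0 ≤ r x ↔ x ∈ S
  eq_zero_iff : ∀ x ∈ C, r x = 0 ↔ x ∈ subBoundary I k S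
  deriv_pos : ∀ x ∈ subBoundary I k S, ∀ ν : TangentSpace I x, PointsInto I k S x ν →
    0 < mvfderiv I r x ν

/-- Local existence of defining functions. The hypothesis `hloc` says that near each of its points
`S` is the part of `C` where the coordinates of `S` lie in the half-space, that is, that `S` has
codimension zero in `C`. -/
theorem exists_local_definingFunction (hC : IsClosed C) (hS : IsClosed S)
    (hSm : IsSubmanifold I k S)
    (hloc : ∀ x ∈ S, ∀ U W φ ψ, IsLocalParam I k S U W φ ψ → x ∈ U →
      ∀ᶠ y in 𝓝[C] x, ψ y ∈ halfSpace k → y ∈ S) (x : X) :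
    ∃ (U : Set X) (ρ : X → ℝ), IsOpen U ∧ x ∈ U ∧ ContMDiffOn I 𝓘(ℝ, ℝ) ∞ ρ U ∧
      ∀ y ∈ C ∩ U, (0 ≤ ρ y ↔ y ∈ S) ∧ (ρ y = 0 ↔ y ∈ subBoundary I k S) ∧
        (y ∈ subBoundary I k S → ∀ ν : TangentSpace I y, PointsInto I k S y ν →
          0 < mvfderiv I ρ y ν) := by
  by_cases hxC : x ∈ C
  swap
  · exact ⟨Cᶜ, fun _ => 0, hC.isOpen_compl, hxC, contMDiffOn_const, fun y hy => absurd hy.1 hy.2⟩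
  by_cases hxS : x ∈ S
  swap
  · refine ⟨Sᶜ, fun _ => -1, hS.isOpen_compl, hxS, contMDiffOn_const, fun y hy => ?_⟩
    have hyb : y ∉ subBoundary I k S := fun h => hy.2 h.1
    have hyS : y ∉ S := hy.2
    refine ⟨?_, ?_, fun h => absurd h hyb⟩ <;> simp [hyb, hyS]
  obtain ⟨U, W, φ, ψ, h, hxU⟩ := hSm x hxS
  have hev := eventually_nhdsWithin_iff.1 (hloc x hxS U W φ ψ h hxU)
  by_cases hxb : x ∈ subBoundary I k S
  swap
  · have hxe : ψ x ∉ halfSpaceEdge k := fun he => hxb ((h.mem_subBoundary_iff hxS hxU).2 he)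
    have h1 := (h.contMDiffAt_ψ hxU).continuousAt.eventually
      (halfSpace_mem_nhds (h.mapsTo_ψ ⟨hxS, hxU⟩).2 hxe)
    obtain ⟨V, hV, hVo, hxV⟩ := eventually_nhds_iff.1
      ((hev.and h1).and ((isClosed_subBoundary hS hSm).isOpen_compl.eventually_mem hxb))
    refine ⟨V, fun _ => 1, hVo, hxV, contMDiffOn_const, fun y hy => ?_⟩
    obtain ⟨⟨hy1, hy2⟩, hy3⟩ := hV y hy.2
    exact ⟨by simpa using hy1 hy.1 hy2, by simpa using hy3, fun h => absurd h hy3⟩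
  · obtain ⟨i, hi, -⟩ := (h.mem_subBoundary_iff hxS hxU).1 hxb
    obtain ⟨V, hV, hVo, hxV⟩ := eventually_nhds_iff.1 (hev.and (h.isOpen_U.eventually_mem hxU))
    refine ⟨V, fun y => ψ y i, hVo, hxV, ?_, fun y hy => ?_⟩
    · intro y hy
      exact ((EuclideanSpace.proj (𝕜 := ℝ) i).contDiff.contMDiff.contMDiffAt.comp y
        (h.contMDiffAt_ψ (hV y hy).2)).contMDiffWithinAt
    · obtain ⟨hy1, hyU⟩ := hV y hy.2
      have hnn : 0 ≤ ψ y i ↔ y ∈ S := by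
        refine ⟨fun h0 => hy1 hy.1 fun j hj => ?_, fun hyS => (h.mapsTo_ψ ⟨hyS, hyU⟩).2 i hi⟩
        rwa [show j = i from Fin.ext (hj.trans hi.symm)]
      refine ⟨hnn, ⟨fun h0 => ?_, fun hyb => ?_⟩, fun hyb ν hν => ?_⟩
      · exact (h.mem_subBoundary_iff (hnn.1 h0.ge) hyU).2 ⟨i, hi, h0⟩
      · exact eq_zero_of_mem_halfSpaceEdge ((h.mem_subBoundary_iff hyb.1 hyU).1 hyb) i hi
      · rw [mvfderiv_coord (h.mdifferentiableAt_ψ hyU)]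
        exact h.mvfderiv_coord_pos hyU hyb hν hi

/-- The local defining functions given by the first coordinate of a parametrization are patched by
a partition of unity. Since they all vanish on `∂S`, the derivatives of the partition functions
do not contribute to the differential of the sum at the points of `∂S`. -/
theorem exists_isDefiningFunction [FiniteDimensional ℝ E] [IsManifold I ∞ X] [T2Space X]
    [SigmaCompactSpace X] (hC : IsClosed C) (hS : IsClosed S) (hSC : S ⊆ C)
    (hSm : IsSubmanifold I k S)
    (hloc : ∀ x ∈ S, ∀ U W φ ψ, IsLocalParam I k S U W φ ψ → x ∈ U →
      ∀ᶠ y in 𝓝[C] x, ψ y ∈ halfSpace k → y ∈ S) :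
    ∃ r : X → ℝ, IsDefiningFunction I k C S r := by
  choose U ρ hUo hxU hρ hρC using exists_local_definingFunction hC hS hSm hloc
  obtain ⟨θ, hθ⟩ := SmoothPartitionOfUnity.exists_isSubordinate I isClosed_univ U hUo
    (fun x _ => mem_iUnion.2 ⟨x, hxU x⟩)
  have hmem : ∀ i y, θ i y ≠ 0 → y ∈ U i := fun i y h => hθ i (subset_tsupport _ h)
  have hconv : ∀ (t : Set ℝ) (y : X), Convex ℝ t → (∀ i, y ∈ U i → ρ i y ∈ t) →
      ∑ᶠ i, θ i y • ρ i y ∈ t := fun t y ht h =>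
    θ.finsum_smul_mem_convex (mem_univ y) (fun i hi => h i (hmem i y hi)) ht
  have hzero : ∀ y ∈ subBoundary I k S, ∑ᶠ i, θ i y • ρ i y = 0 := fun y hy =>
    hconv {0} y (convex_singleton 0) fun i hi => (hρC i y ⟨hSC hy.1, hi⟩).2.1.2 hy
  have hpos : ∀ y ∈ S, y ∉ subBoundary I k S → 0 < ∑ᶠ i, θ i y • ρ i y := fun y hy hyb =>
    hconv (Ioi 0) y (convex_Ioi 0) fun i hi =>
      lt_of_le_of_ne ((hρC i y ⟨hSC hy, hi⟩).1.2 hy) fun h =>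
        hyb ((hρC i y ⟨hSC hy, hi⟩).2.1.1 h.symm)
  have hneg : ∀ y ∈ C, y ∉ S → ∑ᶠ i, θ i y • ρ i y < 0 := fun y hy hyS =>
    hconv (Iio 0) y (convex_Iio 0) fun i hi =>
      lt_of_not_ge fun h => hyS ((hρC i y ⟨hy, hi⟩).1.1 h)
  refine ⟨fun y => ∑ᶠ i, θ i y • ρ i y, hθ.contMDiff_finsum_smul hUo hρ, ?_, ?_, ?_⟩
  · intro y hy
    refine ⟨fun h => by_contra fun hyS => (hneg y hy hyS).not_ge h, fun hyS => ?_⟩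
    by_cases hyb : y ∈ subBoundary I k S
    · exact (hzero y hyb).ge
    · exact (hpos y hyS hyb).le
  · intro y hy
    refine ⟨fun h => by_contra fun hyb => ?_, fun hyb => hzero y hyb⟩
    by_cases hyS : y ∈ S
    · exact (hpos y hyS hyb).ne' h
    · exact (hneg y hy hyS).ne h
  · intro x hx ν hν
    have hr : ContMDiff I 𝓘(ℝ, ℝ) ∞ fun y => ∑ᶠ i, θ i y • ρ i y :=
      hθ.contMDiff_finsum_smul hUo hρ
    obtain ⟨c, hc0, hcS, hc⟩ := id hν.1
    have h1 := hasDerivWithinAt_comp_curve hc0 hc (hr.mdifferentiable (by simp) x)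
    have hsum : (fun y => ∑ᶠ i, θ i y • ρ i y) =ᶠ[𝓝 x]
        fun y => ∑ i ∈ θ.fintsupport x, θ i y * ρ i y := by
      filter_upwards [θ.eventually_finsupport_subset x] with y hy
      refine finsum_eq_sum_of_support_subset _ fun i hi => hy ?_
      exact (θ.mem_finsupport y).2 (left_ne_zero_of_smul hi)
    have h2 : HasDerivWithinAt (fun t => ∑ i ∈ θ.fintsupport x, θ i (c t) * ρ i (c t))
        (∑ i ∈ θ.fintsupport x, θ i x * mvfderiv I (ρ i) x ν) (Ici 0) 0 := by
      refine HasDerivWithinAt.fun_sum fun i hi => ?_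
      have hxi : x ∈ U i := hθ i ((θ.mem_fintsupport_iff x i).1 hi)
      have hρi : MDifferentiableAt I 𝓘(ℝ, ℝ) (ρ i) x :=
        ((hρ i x hxi).contMDiffAt ((hUo i).mem_nhds hxi)).mdifferentiableAt (by simp)
      have h3 := (hasDerivWithinAt_comp_curve hc0 hc
        ((θ i).contMDiff.mdifferentiable (by simp) x)).mul (hasDerivWithinAt_comp_curve hc0 hc hρi)
      convert! h3 using 1
      simp [hc0, (hρC i x ⟨hSC hx.1, hxi⟩).2.1.2 hx]
    have h3 : HasDerivWithinAt ((fun y => ∑ᶠ i, θ i y • ρ i y) ∘ c)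
        (∑ i ∈ θ.fintsupport x, θ i x * mvfderiv I (ρ i) x ν) (Ici 0) 0 := by
      refine h2.congr_of_eventuallyEq ?_ ?_
      · exact ((tendsto_curve hc0 hcS hc).mono_right nhdsWithin_le_nhds).eventually hsum
      · simpa [hc0] using hsum.self_of_nhds
    rw [(uniqueDiffOn_Ici (0:ℝ) 0 (by simp)).eq_deriv _ h1 h3]
    have hterm : ∀ i ∈ θ.fintsupport x, 0 < mvfderiv I (ρ i) x ν := fun i hi =>
      (hρC i x ⟨hSC hx.1, hθ i ((θ.mem_fintsupport_iff x i).1 hi)⟩).2.2 hx ν hν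
    obtain ⟨i, hi⟩ := θ.exists_pos_of_mem (mem_univ x)
    refine Finset.sum_pos' (fun i hi => mul_nonneg (θ.nonneg i x) (hterm i hi).le) ⟨i, ?_, ?_⟩
    · exact θ.finsupport_subset_fintsupport x ((θ.mem_finsupport x).2 hi.ne')
    · exact mul_pos hi (hterm i (θ.finsupport_subset_fintsupport x ((θ.mem_finsupport x).2 hi.ne')))

end DefiningFunction

/-! ### The sets `∂ (Y j)` -/

section Strata

variable {n : ℕ} {X : Type*} [TopologicalSpace X] [ChartedSpace (EuclideanHalfSpace (n + 1)) X]

theorem halfSpace_eq_range (n : ℕ) : halfSpace (n + 1) = range (𝓡∂ (n + 1)) := by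
  rw [range_modelWithCornersEuclideanHalfSpace]
  ext u
  refine ⟨fun h => h 0 rfl, fun h i hi => ?_⟩
  rwa [show i = 0 from Fin.ext hi]

/-- The charts of `X` are local parametrizations of the submanifold `univ`. -/
theorem isLocalParam_extChartAt [IsManifold (𝓡∂ (n + 1)) ∞ X] (x : X) :
    IsLocalParam (𝓡∂ (n + 1)) (n + 1) (univ : Set X) (extChartAt (𝓡∂ (n + 1)) x).source
      ((𝓡∂ (n + 1)).symm ⁻¹' (chartAt (EuclideanHalfSpace (n + 1)) x).target)
      (extChartAt (𝓡∂ (n + 1)) x).symm (extChartAt (𝓡∂ (n + 1)) x) := by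
  have htarget : (𝓡∂ (n + 1)).symm ⁻¹' (chartAt (EuclideanHalfSpace (n + 1)) x).target ∩
      halfSpace (n + 1) = (extChartAt (𝓡∂ (n + 1)) x).target := by
    rw [halfSpace_eq_range, extChartAt_target]
  constructor
  · exact isOpen_extChartAt_source x
  · exact (chartAt _ x).open_target.preimage (𝓡∂ (n + 1)).continuous_symm
  · rw [htarget]; exact contMDiffOn_extChartAt_symm x
  · rw [extChartAt_source]; exact contMDiffOn_extChartAt
  · rw [htarget, univ_inter]; exact (extChartAt _ x).symm.mapsTo
  · rw [htarget, univ_inter]; exact (extChartAt _ x).mapsTo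
  · rw [htarget]; exact (extChartAt _ x).rightInvOn
  · rw [univ_inter]; exact (extChartAt _ x).leftInvOn

theorem subBoundary_univ [IsManifold (𝓡∂ (n + 1)) ∞ X] :
    subBoundary (𝓡∂ (n + 1)) (n + 1) (univ : Set X) = (𝓡∂ (n + 1)).boundary X := by
  ext x
  rw [(isLocalParam_extChartAt x).mem_subBoundary_iff (mem_univ x) (mem_extChartAt_source x)]
  change _ ↔ extChartAt (𝓡∂ (n + 1)) x x ∈ frontier (range (𝓡∂ (n + 1)))
  rw [frontier_range_modelWithCornersEuclideanHalfSpace]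
  refine ⟨fun h => (eq_zero_of_mem_halfSpaceEdge h 0 rfl).symm, fun h => ⟨0, rfl, h.symm⟩⟩

/-- The set `X` for `j = 0` and `∂ (Y (j - 1))` for `j ≥ 1`, where `Y i` is regarded as a
submanifold of dimension `n + 1 - i`. These sets are the strata `∂ⱼX(v')` of the constructed
field. -/
def boundaryStratum (n : ℕ) {X : Type*} [TopologicalSpace X]
    [ChartedSpace (EuclideanHalfSpace (n + 1)) X] (Y : ℕ → Set X) : ℕ → Set X
  | 0 => univ
  | j + 1 => subBoundary (𝓡∂ (n + 1)) (n + 1 - j) (Y j)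

/-- Both `Y j` and the set `boundaryStratum n Y j` containing it have dimension `n + 1 - j`, and the
latter has no boundary for `j ≥ 1`, so that `exists_isDefiningFunction` applies. -/
theorem exists_isDefiningFunction_boundaryStratum [T2Space X] [CompactSpace X]
    [IsManifold (𝓡∂ (n + 1)) ∞ X] {Y : ℕ → Set X} (hY0 : Y 0 = univ)
    (hYc : ∀ j ≤ n + 1, IsClosed (Y j))
    (hYm : ∀ j ≤ n + 1, IsSubmanifold (𝓡∂ (n + 1)) (n + 1 - j) (Y j))
    (hYs : ∀ j ≤ n + 1, Y j ⊆ boundaryStratum n Y j) {j : ℕ} (hj : j ≤ n + 1) :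
    ∃ r : X → ℝ, IsDefiningFunction (𝓡∂ (n + 1)) (n + 1 - j) (boundaryStratum n Y j) (Y j) r := by
  obtain _ | j := j
  · refine exists_isDefiningFunction isClosed_univ (hYc 0 hj) (hYs 0 hj) (hYm 0 hj) ?_
    intro x _ U W φ ψ _ _
    exact Eventually.of_forall fun y _ => hY0 ▸ mem_univ y
  · refine exists_isDefiningFunction (isClosed_subBoundary (hYc j (by omega)) (hYm j (by omega)))
      (hYc _ hj) (hYs _ hj) (hYm _ hj) ?_
    intro x hx U W φ ψ h hxU
    obtain ⟨U', W', φ', ψ', h', hxU', hW'⟩ := exists_isLocalParam_subBoundary (hYs _ hj hx)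
    exact h.eventually_mem_of_subset h' hW' (hYs _ hj) hx hxU hxU'

end Strata

/-! ### Tangent spaces and tangent cones in terms of defining functions -/

section Tower

variable {n : ℕ} {X : Type*} [TopologicalSpace X] [ChartedSpace (EuclideanHalfSpace (n + 1)) X]

variable (n) in
/-- A nested sequence `Y 0 ⊇ Y 1 ⊇ … ⊇ Y (n + 1)` with `Y (j + 1) ⊆ ∂ (Y j)`, together with
functions `r j` which define `Y j` inside `X` for `j = 0` and inside `∂ (Y (j - 1))` for `j ≥ 1`. -/
structure IsDefiningTower (Y : ℕ → Set X) (r : ℕ → X → ℝ) : Prop where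
  subset : ∀ j ≤ n + 1, Y j ⊆ boundaryStratum n Y j
  defining : ∀ j ≤ n + 1,
    IsDefiningFunction (𝓡∂ (n + 1)) (n + 1 - j) (boundaryStratum n Y j) (Y j) (r j)

/-- The common kernel at `x` of the differentials of `r 0, …, r (j - 1)`. -/
noncomputable def jointKer (n : ℕ) {X : Type*} [TopologicalSpace X]
    [ChartedSpace (EuclideanHalfSpace (n + 1)) X] (r : ℕ → X → ℝ) (j : ℕ) (x : X) :
    Submodule ℝ (TangentSpace (𝓡∂ (n + 1)) x) :=
  ⨅ i : Fin j, LinearMap.ker (mvfderiv (𝓡∂ (n + 1)) (r i) x).toLinearMap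

theorem mem_jointKer {r : ℕ → X → ℝ} {j : ℕ} {x : X} {w : TangentSpace (𝓡∂ (n + 1)) x} :
    w ∈ jointKer n r j x ↔ ∀ i < j, mvfderiv (𝓡∂ (n + 1)) (r i) x w = 0 := by
  simp only [jointKer, Submodule.mem_iInf, Fin.forall_iff]
  rfl

theorem mem_jointKer_succ {r : ℕ → X → ℝ} {j : ℕ} {x : X} {w : TangentSpace (𝓡∂ (n + 1)) x} :
    w ∈ jointKer n r (j + 1) x ↔
      w ∈ jointKer n r j x ∧ mvfderiv (𝓡∂ (n + 1)) (r j) x w = 0 := by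
  simp only [mem_jointKer, Nat.lt_succ_iff_lt_or_eq]
  exact ⟨fun h => ⟨fun i hi => h i (Or.inl hi), h j (Or.inr rfl)⟩,
    fun h i hi => hi.elim (h.1 i) fun e => e ▸ h.2⟩

namespace IsDefiningTower

variable {Y : ℕ → Set X} {r : ℕ → X → ℝ} {j : ℕ} {x : X}

theorem stratum_succ_subset (h : IsDefiningTower n Y r) (hj : j ≤ n + 1) :
    boundaryStratum n Y (j + 1) ⊆ boundaryStratum n Y j :=
  fun _ hx => h.subset j hj hx.1

theorem mdifferentiableAt (h : IsDefiningTower n Y r) (hj : j ≤ n + 1) (x : X) :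
    MDifferentiableAt (𝓡∂ (n + 1)) 𝓘(ℝ, ℝ) (r j) x :=
  (h.defining j hj).smooth.mdifferentiable (by simp) x

theorem mem_stratum_succ (h : IsDefiningTower n Y r) (hj : j ≤ n + 1) :
    x ∈ boundaryStratum n Y (j + 1) ↔ x ∈ boundaryStratum n Y j ∧ r j x = 0 :=
  ⟨fun hx => ⟨h.stratum_succ_subset hj hx,
    ((h.defining j hj).eq_zero_iff x (h.stratum_succ_subset hj hx)).2 hx⟩,
    fun hx => ((h.defining j hj).eq_zero_iff x hx.1).1 hx.2⟩

theorem mem_stratum (h : IsDefiningTower n Y r) (hj : j ≤ n + 2) :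
    x ∈ boundaryStratum n Y j ↔ ∀ i < j, r i x = 0 := by
  induction j with
  | zero => simp [boundaryStratum]
  | succ j ih =>
    rw [h.mem_stratum_succ (by omega), ih (by omega)]
    exact ⟨fun hx i hi => (Nat.lt_succ_iff_lt_or_eq.1 hi).elim (hx.1 i) fun e => e ▸ hx.2,
      fun hx => ⟨fun i hi => hx i (by omega), hx j (by omega)⟩⟩

theorem tangentCone_subset_jointKer (h : IsDefiningTower n Y r) (hj : j ≤ n + 1)
    (hx : x ∈ boundaryStratum n Y j) :
    tangentCone (𝓡∂ (n + 1)) (boundaryStratum n Y j) x ⊆ jointKer n r j x := by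
  intro w hw
  refine mem_jointKer.2 fun i hi => ?_
  refine mvfderiv_eq_zero_of_mem_tangentCone hw (h.mdifferentiableAt (by omega) x) ?_
  filter_upwards [self_mem_nhdsWithin] with y hy
  rw [(h.mem_stratum (by omega)).1 hy i hi, (h.mem_stratum (by omega)).1 hx i hi]

theorem exists_mem_jointKer_pos (h : IsDefiningTower n Y r) (hj : j ≤ n + 1)
    (hx : x ∈ boundaryStratum n Y (j + 1)) :
    ∃ w ∈ tangentCone (𝓡∂ (n + 1)) (Y j) x, w ∈ jointKer n r j x ∧
      0 < mvfderiv (𝓡∂ (n + 1)) (r j) x w := by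
  obtain ⟨ν, hν⟩ := exists_pointsInto hx
  exact ⟨ν, hν.1, h.tangentCone_subset_jointKer hj (h.stratum_succ_subset hj hx)
    (tangentCone_mono (h.subset j hj) hν.1), (h.defining j hj).deriv_pos x hx ν hν⟩

instance finiteDimensional_tangentSpace (x : X) :
    FiniteDimensional ℝ (TangentSpace (𝓡∂ (n + 1)) x) :=
  inferInstanceAs (FiniteDimensional ℝ (EuclideanSpace ℝ (Fin (n + 1))))

/-- At a common zero of `r 0, …, r (j - 1)` their differentials are independent: the `i`-th one does
not vanish on the common kernel of the previous ones, since it is positive on a vector pointing into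
`Y i`. -/
theorem finrank_jointKer_add_le (h : IsDefiningTower n Y r) (hj : j ≤ n + 2)
    (hx : x ∈ boundaryStratum n Y j) : Module.finrank ℝ (jointKer n r j x) + j ≤ n + 1 := by
  induction j with
  | zero =>
    refine (Submodule.finrank_le _).trans (le_of_eq ?_)
    exact (finrank_euclideanSpace_fin (𝕜 := ℝ) (n := n + 1))
  | succ j ih =>
    have h1 := ih (by omega) (h.stratum_succ_subset (by omega) hx)
    obtain ⟨w, -, hw, hpos⟩ := h.exists_mem_jointKer_pos (by omega) hx
    have h2 : jointKer n r (j + 1) x < jointKer n r j x :=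
      lt_of_le_of_ne (fun w hw => (mem_jointKer_succ.1 hw).1) fun he =>
        hpos.ne' (mem_jointKer_succ.1 (he ▸ hw : w ∈ jointKer n r (j + 1) x)).2
    have h3 := Submodule.finrank_lt_finrank_of_lt h2
    omega

/-- The zero-dimensional `Y (n + 1)` has no boundary, as `n + 2` differentials cannot be
independent. -/
theorem stratum_eq_empty (h : IsDefiningTower n Y r) : boundaryStratum n Y (n + 2) = ∅ :=
  eq_empty_of_forall_notMem fun x hx => by
    have := h.finrank_jointKer_add_le le_rfl hx
    omega

/-- At a point of `∂ (Y j)` the tangent space of `Y j` is contained in the joint kernel of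
`dr_0, …, dr_{j-1}`, and equals it by a dimension count. Within it, the sign of `dr_j` tells the
vectors directed into `Y j`, and its kernel consists of the vectors tangent to `∂ (Y j)`. -/
theorem mem_tangentCone_of_mem_jointKer (h : IsDefiningTower n Y r) (hj : j ≤ n + 1)
    (hx : x ∈ boundaryStratum n Y (j + 1)) {w : TangentSpace (𝓡∂ (n + 1)) x}
    (hw : w ∈ jointKer n r j x) :
    (0 ≤ mvfderiv (𝓡∂ (n + 1)) (r j) x w → w ∈ tangentCone (𝓡∂ (n + 1)) (Y j) x) ∧
    (mvfderiv (𝓡∂ (n + 1)) (r j) x w = 0 →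
      w ∈ tangentCone (𝓡∂ (n + 1)) (boundaryStratum n Y (j + 1)) x) := by
  obtain ⟨hxY, U, W, φ, ψ, hp, hxU, hxe⟩ := id hx
  obtain ⟨D, -, hD1, hD2, hD3, hD4⟩ := hp.exists_differential hxY hxU
  obtain ⟨i, hi, hi0⟩ := id hxe
  have hxj := h.stratum_succ_subset hj hx
  have hcone : ∀ a ∈ halfSpace (n + 1 - j), D a ∈ jointKer n r j x := fun a ha =>
    h.tangentCone_subset_jointKer hj hxj (tangentCone_mono (h.subset j hj) (hD2 a fun _ => ha))
  have hrange : LinearMap.range D.toLinearMap ≤ jointKer n r j x := by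
    rintro _ ⟨a, rfl⟩
    by_cases ha : a ∈ halfSpace (n + 1 - j)
    · exact hcone a ha
    · have := hcone (-a) (neg_mem_halfSpace ha)
      rw [map_neg] at this
      exact (Submodule.neg_mem_iff _).1 this
  have hinj : Function.Injective D.toLinearMap := fun a b hab => by
    rw [← hD1 a, ← hD1 b]; exact congrArg _ hab
  have heq : LinearMap.range D.toLinearMap = jointKer n r j x := by
    refine Submodule.eq_of_le_of_finrank_le hrange ?_
    rw [LinearMap.finrank_range_of_inj hinj, finrank_euclideanSpace_fin]
    have := h.finrank_jointKer_add_le (by omega) hxj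
    omega
  obtain ⟨a, rfl⟩ : w ∈ LinearMap.range D.toLinearMap := heq ▸ hw
  change (0 ≤ mvfderiv (𝓡∂ (n + 1)) (r j) x (D a) → D a ∈ _) ∧
    (mvfderiv (𝓡∂ (n + 1)) (r j) x (D a) = 0 → D a ∈ _)
  have hpos : ∀ a : EuclideanSpace ℝ (Fin (n + 1 - j)), 0 < a i →
      0 < mvfderiv (𝓡∂ (n + 1)) (r j) x (D a) := by
    intro a ha
    refine (h.defining j hj).deriv_pos x hx _ (hp.pointsInto hxU hx ?_ hi ?_)
    · refine hD2 a fun _ l hl => ?_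
      rw [show l = i from Fin.ext (hl.trans hi.symm)]
      exact ha.le
    · rwa [hD1]
  have hneg : a i < 0 → mvfderiv (𝓡∂ (n + 1)) (r j) x (D a) < 0 := fun ha => by
    have := hpos (-a) (by simpa using ha)
    rw [map_neg, map_neg] at this
    linarith
  refine ⟨fun h0 => hD2 a fun _ l hl => ?_, fun h0 => hD3 a hxe fun l hl => ?_⟩
  · rw [show l = i from Fin.ext (hl.trans hi.symm)]
    exact not_lt.1 fun hlt => (hneg hlt).not_ge h0
  · rw [show l = i from Fin.ext (hl.trans hi.symm)]
    exact le_antisymm (not_lt.1 fun hlt => (hpos a hlt).ne' h0)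
      (not_lt.1 fun hlt => (hneg hlt).ne h0)

theorem tangentSub_stratum (h : IsDefiningTower n Y r) (hj : j ≤ n + 1)
    (hx : x ∈ boundaryStratum n Y j) :
    tangentSub (𝓡∂ (n + 1)) (boundaryStratum n Y j) x ≤ jointKer n r j x :=
  Submodule.span_le.2 (h.tangentCone_subset_jointKer hj hx)

theorem mem_tangentSub_stratum_iff (h : IsDefiningTower n Y r) (hj : j ≤ n)
    (hx : x ∈ boundaryStratum n Y (j + 1)) {w : TangentSpace (𝓡∂ (n + 1)) x} :
    w ∈ tangentSub (𝓡∂ (n + 1)) (boundaryStratum n Y (j + 1)) x ↔ w ∈ jointKer n r (j + 1) x := by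
  refine ⟨fun hw => h.tangentSub_stratum (by omega) hx hw, fun hw => ?_⟩
  obtain ⟨hw1, hw2⟩ := mem_jointKer_succ.1 hw
  exact Submodule.subset_span ((h.mem_tangentCone_of_mem_jointKer (by omega) hx hw1).2 hw2)

theorem mem_tangentCone_iff (h : IsDefiningTower n Y r) (hj : j ≤ n + 1)
    (hx : x ∈ boundaryStratum n Y (j + 1)) {w : TangentSpace (𝓡∂ (n + 1)) x} :
    w ∈ tangentCone (𝓡∂ (n + 1)) (Y j) x ↔
      w ∈ jointKer n r j x ∧ 0 ≤ mvfderiv (𝓡∂ (n + 1)) (r j) x w := by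
  refine ⟨fun hw => ⟨?_, ?_⟩, fun hw => (h.mem_tangentCone_of_mem_jointKer hj hx hw.1).1 hw.2⟩
  · exact h.tangentCone_subset_jointKer hj (h.stratum_succ_subset hj hx)
      (tangentCone_mono (h.subset j hj) hw)
  · refine mvfderiv_nonneg_of_mem_tangentCone hw (h.mdifferentiableAt hj x) ?_
    filter_upwards [self_mem_nhdsWithin] with y hy
    rw [((h.mem_stratum_succ hj).1 hx).2]
    exact ((h.defining j hj).nonneg_iff y (h.subset j hj hy)).2 hy

theorem pointsInto_of_mem_jointKer (h : IsDefiningTower n Y r) (hj : j ≤ n)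
    (hx : x ∈ boundaryStratum n Y (j + 1)) {w : TangentSpace (𝓡∂ (n + 1)) x}
    (hw : w ∈ jointKer n r j x) (hpos : 0 < mvfderiv (𝓡∂ (n + 1)) (r j) x w) :
    PointsInto (𝓡∂ (n + 1)) (n + 1 - j) (Y j) x w :=
  ⟨(h.mem_tangentCone_iff (by omega) hx).2 ⟨hw, hpos.le⟩, fun hmem => hpos.ne'
    (mem_jointKer_succ.1 ((h.mem_tangentSub_stratum_iff hj hx).1 hmem)).2⟩

end IsDefiningTower

end Tower

/-! ### Construction of the adapted field -/

section LocalField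

variable {E : Type*} [NormedAddCommGroup E] [NormedSpace ℝ E]
  {H : Type*} [TopologicalSpace H] {I : ModelWithCorners ℝ E H}
  {X : Type*} [TopologicalSpace X] [ChartedSpace H X] [IsManifold I ∞ X]

theorem contMDiffAt_mvfderiv_apply {g : X → ℝ} (hg : ContMDiff I 𝓘(ℝ, ℝ) ∞ g)
    {s : ∀ y : X, TangentSpace I y} {x : X}
    (hs : ContMDiffAt I I.tangent ∞ (fun y => (⟨y, s y⟩ : TangentBundle I X)) x) :
    ContMDiffAt I 𝓘(ℝ, ℝ) ∞ (fun y => mvfderiv I g y (s y)) x := by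
  have h1 : ContMDiff I.tangent 𝓘(ℝ, ℝ).tangent ∞ (tangentMap I 𝓘(ℝ, ℝ) g) :=
    hg.contMDiff_tangentMap (by simp)
  exact (contMDiff_snd_tangentBundle_modelSpace ℝ 𝓘(ℝ, ℝ)).contMDiffAt.comp x
    (h1.contMDiffAt.comp x hs)

/-- Extension of a tangent vector `w₀` to a local field `s` along which the derivatives of
`r 0, …, r (j - 1)` are prescribed functions, when the differentials at `x` are in triangular form
with respect to some vectors. In the inductive step, the field obtained for `j` is corrected by a
multiple of a field that kills `r 0, …, r (j - 1)` but not `r j`. -/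
theorem exists_local_field {r : ℕ → X → ℝ} {x : X} (j : ℕ)
    (hr : ∀ i < j, ContMDiff I 𝓘(ℝ, ℝ) ∞ (r i))
    (hind : ∀ i < j, ∃ w : TangentSpace I x, (∀ l < i, mvfderiv I (r l) x w = 0) ∧
      mvfderiv I (r i) x w ≠ 0)
    {b : ℕ → X → ℝ} (hb : ∀ i < j, ContMDiff I 𝓘(ℝ, ℝ) ∞ (b i)) (w₀ : TangentSpace I x)
    (hw₀ : ∀ i < j, mvfderiv I (r i) x w₀ = b i x) :
    ∃ s : ∀ y : X, TangentSpace I y,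
      (∀ᶠ y in 𝓝 x, ContMDiffAt I I.tangent ∞ (fun y => (⟨y, s y⟩ : TangentBundle I X)) y) ∧
      s x = w₀ ∧ ∀ i < j, ∀ᶠ y in 𝓝 x, mvfderiv I (r i) y (s y) = b i y := by
  induction j generalizing b w₀ with
  | zero =>
    refine ⟨FiberBundle.extend E w₀, ?_, ?_, fun i hi => absurd hi (Nat.not_lt_zero i)⟩
    · obtain ⟨u, hu, hs⟩ := FiberBundle.exists_contMDiffOn_extend (k := ∞) I E w₀
      filter_upwards [eventually_mem_nhds_iff.2 hu] with y hy
      exact (hs y (mem_of_mem_nhds hy)).contMDiffAt hy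
    · exact FiberBundle.extend_apply_self E w₀
  | succ j ih =>
    obtain ⟨w₁, hw₁, hw₁j⟩ := hind j (by omega)
    obtain ⟨s, hs, hsx, hsr⟩ := ih (fun i hi => hr i (by omega)) (fun i hi => hind i (by omega))
      (fun i hi => hb i (by omega)) w₀ (fun i hi => hw₀ i (by omega))
    obtain ⟨e, he, hex, her⟩ := ih (fun i hi => hr i (by omega)) (fun i hi => hind i (by omega))
      (b := fun _ _ => 0) (fun i hi => contMDiff_const) w₁ hw₁
    have hrj := hr j (by omega)
    have hbj := hb j (by omega)
    have hne : ∀ᶠ y in 𝓝 x, mvfderiv I (r j) y (e y) ≠ 0 := by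
      refine (contMDiffAt_mvfderiv_apply hrj he.self_of_nhds).continuousAt.eventually_ne ?_
      rwa [hex]
    set q : X → ℝ := fun y =>
      (b j y - mvfderiv I (r j) y (s y)) * (mvfderiv I (r j) y (e y))⁻¹ with hq
    refine ⟨s + q • e, ?_, ?_, ?_⟩
    · filter_upwards [hs, he, hne] with y hsy hey hney
      refine hsy.add_section (ContMDiffAt.smul_section ?_ hey)
      exact (hbj.contMDiffAt.sub (contMDiffAt_mvfderiv_apply hrj hsy)).mul
        ((contDiffAt_inv ℝ hney).contMDiffAt.comp y (contMDiffAt_mvfderiv_apply hrj hey))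
    · have : q x = 0 := by simp [hq, hsx, hw₀ j (by omega)]
      simp [this, hsx]
    · intro i hi
      rcases Nat.lt_succ_iff_lt_or_eq.1 hi with hi' | rfl
      · filter_upwards [hsr i hi', her i hi'] with y h1 h2
        simp [h1, h2]
      · filter_upwards [hne] with y h1
        simp [hq, h1]

end LocalField

section AdaptedField

variable {n : ℕ} {X : Type*} [TopologicalSpace X] [ChartedSpace (EuclideanHalfSpace (n + 1)) X]
  {Y : ℕ → Set X} {r : ℕ → X → ℝ} {f : X → ℝ}

namespace IsDefiningTower

/-- The sign conditions at the critical points are what is needed to find, at each boundary point, a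
tangent vector that has the prescribed derivatives and increases `f`. The point `x` is in `∂ (Y p)`
but not in `∂ (Y (p + 1))`, so that `r (p + 1) x ≠ 0`. -/
theorem exists_vector (h : IsDefiningTower n Y r)
    (hpos : ∀ j, 1 ≤ j → j ≤ n + 1 → ∀ x ∈ critSet (𝓡∂ (n + 1)) f (Y j),
      ∀ ν : TangentSpace (𝓡∂ (n + 1)) x,
        PointsInto (𝓡∂ (n + 1)) (n + 1 - (j - 1)) (Y (j - 1)) x ν →
          0 < mvfderiv (𝓡∂ (n + 1)) f x ν)
    (hneg : ∀ j, 1 ≤ j → j ≤ n + 1 →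
      ∀ x ∈ critSet (𝓡∂ (n + 1)) f
          (subBoundary (𝓡∂ (n + 1)) (n + 1 - (j - 1)) (Y (j - 1))) \
          critSet (𝓡∂ (n + 1)) f (Y j),
      ∀ ν : TangentSpace (𝓡∂ (n + 1)) x,
        PointsInto (𝓡∂ (n + 1)) (n + 1 - (j - 1)) (Y (j - 1)) x ν →
          mvfderiv (𝓡∂ (n + 1)) f x ν < 0)
    {p : ℕ} (hp : p ≤ n) {x : X} (hx : x ∈ boundaryStratum n Y (p + 1))
    (hx' : x ∉ boundaryStratum n Y (p + 2)) :
    ∃ w ∈ jointKer n r p x, mvfderiv (𝓡∂ (n + 1)) (r p) x w = r (p + 1) x ∧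
      0 < mvfderiv (𝓡∂ (n + 1)) f x w := by
  have hr0 : r (p + 1) x ≠ 0 := fun h0 => hx' ((h.mem_stratum_succ (by omega)).2 ⟨hx, h0⟩)
  obtain ⟨u, -, hu, hu0⟩ := h.exists_mem_jointKer_pos (by omega) hx
  obtain ⟨w, hwk, hwr⟩ : ∃ w ∈ jointKer n r p x,
      mvfderiv (𝓡∂ (n + 1)) (r p) x w = r (p + 1) x :=
    ⟨(r (p + 1) x / mvfderiv (𝓡∂ (n + 1)) (r p) x u) • u, Submodule.smul_mem _ _ hu, by
      rw [map_smul, smul_eq_mul, div_mul_cancel₀ _ hu0.ne']⟩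
  -- if `df` is nonzero on the tangent space of `∂ (Y p)`, then `w` is corrected to get `df = 1`
  by_cases hcrit : ∃ a ∈ jointKer n r (p + 1) x, mvfderiv (𝓡∂ (n + 1)) f x a ≠ 0
  · obtain ⟨a, ha, haf⟩ := hcrit
    obtain ⟨hak, har⟩ := mem_jointKer_succ.1 ha
    refine ⟨w + ((1 - mvfderiv (𝓡∂ (n + 1)) f x w) / mvfderiv (𝓡∂ (n + 1)) f x a) • a,
      Submodule.add_mem _ hwk (Submodule.smul_mem _ _ hak), ?_, ?_⟩
    · rw [map_add, map_smul, har, hwr, smul_zero, add_zero]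
    · rw [map_add, map_smul, smul_eq_mul, div_mul_cancel₀ _ haf]
      simp
  · push Not at hcrit
    refine ⟨w, hwk, hwr, ?_⟩
    have hcritC : x ∈ critSet (𝓡∂ (n + 1)) f (boundaryStratum n Y (p + 1)) :=
      ⟨hx, fun w hw => hcrit w (h.tangentSub_stratum (by omega) hx hw)⟩
    -- `-w` points into `Y p` off `Y (p + 1)`, and `w` does so on `Y (p + 1)`
    rcases hr0.lt_or_gt with hlt | hgt
    · have hxY : x ∉ Y (p + 1) := fun hxY =>
        hlt.not_ge (((h.defining (p + 1) (by omega)).nonneg_iff x hx).2 hxY)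
      have := hneg (p + 1) (by omega) (by omega) x ⟨hcritC, fun hc => hxY hc.1⟩ (-w)
        (h.pointsInto_of_mem_jointKer hp hx (Submodule.neg_mem _ hwk)
          (by rw [map_neg, hwr]; linarith))
      rw [map_neg] at this
      linarith
    · have hxY : x ∈ Y (p + 1) := ((h.defining (p + 1) (by omega)).nonneg_iff x hx).1 hgt.le
      refine hpos (p + 1) (by omega) (by omega) x ⟨hxY, fun w hw => hcrit w ?_⟩ w
        (h.pointsInto_of_mem_jointKer hp hx hwk (by rwa [hwr]))
      exact h.tangentSub_stratum (by omega) hx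
        (Submodule.span_mono (tangentCone_mono (h.subset _ (by omega))) hw)

/-- The condition `dr_j(v') = r_{j+1}` on `∂ (Y j)`, together with `df(v') > 0` off the critical
points of `f` and `v' = v` near them, is convex at each point, so that local solutions can be
patched. -/
theorem exists_adapted_field [T2Space X] [CompactSpace X] [IsManifold (𝓡∂ (n + 1)) ∞ X]
    (h : IsDefiningTower n Y r) (hf : ContMDiff (𝓡∂ (n + 1)) 𝓘(ℝ, ℝ) ∞ f)
    (hfb : ∀ x ∈ boundaryStratum n Y 1, mvfderiv (𝓡∂ (n + 1)) f x ≠ 0)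
    {v : ∀ x : X, TangentSpace (𝓡∂ (n + 1)) x} (hv : IsGradientLike f v)
    (hvec : ∀ p ≤ n, ∀ x ∈ boundaryStratum n Y (p + 1), x ∉ boundaryStratum n Y (p + 2) →
      ∃ w ∈ jointKer n r p x, mvfderiv (𝓡∂ (n + 1)) (r p) x w = r (p + 1) x ∧
        0 < mvfderiv (𝓡∂ (n + 1)) f x w) :
    ∃ v' : ∀ x : X, TangentSpace (𝓡∂ (n + 1)) x, IsSmoothField v' ∧
      (∀ x, mvfderiv (𝓡∂ (n + 1)) f x ≠ 0 → 0 < mvfderiv (𝓡∂ (n + 1)) f x (v' x)) ∧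
      (∃ N : Set X, IsOpen N ∧ (∀ x, mvfderiv (𝓡∂ (n + 1)) f x = 0 → x ∈ N) ∧
        ∀ x ∈ N, v' x = v x) ∧
      ∀ j ≤ n, ∀ x ∈ boundaryStratum n Y (j + 1),
        mvfderiv (𝓡∂ (n + 1)) (r j) x (v' x) = r (j + 1) x := by
  have hC1 : ∀ x, x ∈ boundaryStratum n Y 1 ↔ r 0 x = 0 := fun x => by
    rw [h.mem_stratum_succ (by omega)]; simp [boundaryStratum]
  have hr0c : Continuous (r 0) := (h.defining 0 (by omega)).smooth.continuous
  have hC1c : IsClosed (boundaryStratum n Y 1) := by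
    have : boundaryStratum n Y 1 = {x | r 0 x = 0} := ext hC1
    rw [this]
    exact isClosed_eq hr0c continuous_const
  have hC1sub : ∀ j ≤ n, boundaryStratum n Y (j + 1) ⊆ boundaryStratum n Y 1 := fun j hj x hx =>
    (hC1 x).2 ((h.mem_stratum (by omega)).1 hx 0 (by omega))
  -- `v` is kept on the set `{df(v) < ε}`, where `ε` is less than `df(v)` on the boundary
  set g : X → ℝ := fun x => mvfderiv (𝓡∂ (n + 1)) f x (v x) with hg
  have hgc : Continuous g := continuous_iff_continuousAt.2 fun x =>
    (contMDiffAt_mvfderiv_apply hf hv.smooth.contMDiffAt).continuousAt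
  obtain ⟨ε, hε, hεb⟩ : ∃ ε, 0 < ε ∧ ∀ x ∈ boundaryStratum n Y 1, ε ≤ g x :=
    hC1c.isCompact.exists_forall_le' hgc.continuousOn fun x hx =>
      hv.pos x fun h0 => hfb x hx ((hv.zero_iff x).1 h0)
  set N : Set X := {x | g x < ε / 2} with hN
  set T : ∀ x : X, Set (TangentSpace (𝓡∂ (n + 1)) x) := fun x =>
    {w | (mvfderiv (𝓡∂ (n + 1)) f x ≠ 0 → 0 < mvfderiv (𝓡∂ (n + 1)) f x w) ∧
      (x ∈ N → w = v x) ∧ ∀ j ≤ n, x ∈ boundaryStratum n Y (j + 1) →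
        mvfderiv (𝓡∂ (n + 1)) (r j) x w = r (j + 1) x} with hT
  have hTconv : ∀ x, Convex ℝ (T x) := by
    intro x a ha b hb s t hs ht hst
    refine ⟨fun hx => ?_, fun hx => ?_, fun j hj hx => ?_⟩
    · rw [map_add, map_smul, map_smul]
      exact (convex_Ioi (0:ℝ)) (ha.1 hx) (hb.1 hx) hs ht hst
    · rw [ha.2.1 hx, hb.2.1 hx, ← add_smul, hst, one_smul]
    · rw [map_add, map_smul, map_smul, ha.2.2 j hj hx, hb.2.2 j hj hx, ← add_smul, hst, one_smul]
  have hloc : ∀ x : X, ∃ U ∈ 𝓝 x, ∃ s : ∀ y : X, TangentSpace (𝓡∂ (n + 1)) y,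
      ContMDiffOn (𝓡∂ (n + 1)) (𝓡∂ (n + 1)).tangent ∞
        (fun y => (⟨y, s y⟩ : TangentBundle (𝓡∂ (n + 1)) X)) U ∧ ∀ y ∈ U, s y ∈ T y := by
    intro x
    by_cases hx : x ∈ boundaryStratum n Y 1
    swap
    · refine ⟨(boundaryStratum n Y 1)ᶜ, hC1c.isOpen_compl.mem_nhds hx, v, hv.smooth.contMDiffOn,
        fun y hy => ⟨fun hy0 => hv.pos y fun h0 => hy0 ((hv.zero_iff y).1 h0), fun _ => rfl,
          fun j hj hyj => absurd (hC1sub j hj hyj) hy⟩⟩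
    -- the largest `p` with `x ∈ ∂ (Y p)`
    obtain ⟨p, hp, hxp, hxp'⟩ : ∃ p ≤ n, x ∈ boundaryStratum n Y (p + 1) ∧
        x ∉ boundaryStratum n Y (p + 2) := by
      by_contra! hcon
      have : ∀ j ≤ n + 1, x ∈ boundaryStratum n Y (j + 1) := by
        intro j
        induction j with
        | zero => exact fun _ => hx
        | succ j ih => exact fun hj => hcon j (by omega) (ih (by omega))
      exact h.stratum_eq_empty.subset (this (n + 1) le_rfl)
    obtain ⟨w, hwk, hwr, hwf⟩ := hvec p hp x hxp hxp'
    have hxr := (h.mem_stratum (by omega)).1 hxp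
    obtain ⟨s, hs, hsx, hsr⟩ := exists_local_field (I := 𝓡∂ (n + 1)) (r := r) (x := x) (p + 1)
      (fun i hi => (h.defining i (by omega)).smooth)
      (fun i hi => by
        obtain ⟨w, -, hw, hw0⟩ := h.exists_mem_jointKer_pos (j := i) (x := x) (by omega)
          ((h.mem_stratum (by omega)).2 fun l hl => hxr l (by omega))
        exact ⟨w, mem_jointKer.1 hw, hw0.ne'⟩)
      (b := fun i => r (i + 1)) (fun i hi => (h.defining (i + 1) (by omega)).smooth) w
      (fun i hi => by
        rcases Nat.lt_succ_iff_lt_or_eq.1 hi with hi' | rfl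
        · rw [mem_jointKer.1 hwk i hi', hxr (i + 1) (by omega)]
        · exact hwr)
    have hsr' : ∀ᶠ y in 𝓝 x, ∀ i < p + 1, mvfderiv (𝓡∂ (n + 1)) (r i) y (s y) = r (i + 1) y := by
      simpa using (Finset.eventually_all (Finset.range (p + 1))).2 fun i hi =>
        hsr i (Finset.mem_range.1 hi)
    have hsf : ∀ᶠ y in 𝓝 x, 0 < mvfderiv (𝓡∂ (n + 1)) f y (s y) := by
      refine (contMDiffAt_mvfderiv_apply hf hs.self_of_nhds).continuousAt.eventually_const_lt ?_
      change 0 < mvfderiv (𝓡∂ (n + 1)) f x (s x)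
      rwa [hsx]
    have hrp : ∀ᶠ y in 𝓝 x, r (p + 1) y ≠ 0 :=
      (h.defining (p + 1) (by omega)).smooth.continuous.continuousAt.eventually_ne fun h0 =>
        hxp' ((h.mem_stratum_succ (by omega)).2 ⟨hxp, h0⟩)
    have hgx : ∀ᶠ y in 𝓝 x, ε / 2 < g y :=
      hgc.continuousAt.eventually_const_lt (by have := hεb x hx; linarith)
    -- near `x` only the conditions with `j ≤ p` are effective, since `r (p + 1)` does not vanish
    refine ⟨_, hs.and (hsr'.and (hsf.and (hrp.and hgx))), s, fun y hy => hy.1.contMDiffWithinAt,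
      fun y hy => ?_⟩
    obtain ⟨-, hyr, hyf, hyp, hyg⟩ := hy
    refine ⟨fun _ => hyf, fun hyN => absurd hyN (not_lt.2 hyg.le), fun j hj hyj => hyr j ?_⟩
    by_contra hjp
    exact hyp ((h.mem_stratum (by omega)).1 hyj (p + 1) (by omega))
  obtain ⟨s, hs⟩ := exists_contMDiffSection_forall_mem_convex_of_local (𝓡∂ (n + 1)) (n := ⊤)
    (F_fiber := EuclideanSpace ℝ (Fin (n + 1)))
    (fun x : X => TangentSpace (𝓡∂ (n + 1)) x) T hTconv hloc
  refine ⟨fun x => s x, s.contMDiff, fun x => (hs x).1, ⟨N, ?_, fun x hx => ?_,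
    fun x => (hs x).2.1⟩, fun j hj x => (hs x).2.2 j hj⟩
  · exact isOpen_lt hgc continuous_const
  · change mvfderiv (𝓡∂ (n + 1)) f x (v x) < ε / 2
    rw [hx]
    exact half_pos hε

end IsDefiningTower

end AdaptedField

/-! ### Strata and genericity of the adapted field -/

section Verification

variable {n : ℕ} {X : Type*} [TopologicalSpace X] [ChartedSpace (EuclideanHalfSpace (n + 1)) X]
  {Y : ℕ → Set X} {r : ℕ → X → ℝ} {v : ∀ x : X, TangentSpace (𝓡∂ (n + 1)) x} {j : ℕ} {x : X}

namespace IsDefiningTower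

/-- A field adapted to the defining functions is tangent to `∂ (Y (j - 1))` along `∂ (Y j)`. -/
theorem mem_jointKer_of_mem_stratum (h : IsDefiningTower n Y r)
    (hvr : ∀ j ≤ n, ∀ x ∈ boundaryStratum n Y (j + 1),
      mvfderiv (𝓡∂ (n + 1)) (r j) x (v x) = r (j + 1) x)
    (hj : j ≤ n + 1) (hx : x ∈ boundaryStratum n Y (j + 1)) : v x ∈ jointKer n r j x := by
  have hxr := (h.mem_stratum (by omega)).1 hx
  refine mem_jointKer.2 fun i hi => ?_
  rw [hvr i (by omega) x ((h.mem_stratum (by omega)).2 fun l hl => hxr l (by omega)),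
    hxr (i + 1) (by omega)]

theorem mem_tangentSub_iff_mem_stratum (h : IsDefiningTower n Y r)
    (hvr : ∀ j ≤ n, ∀ x ∈ boundaryStratum n Y (j + 1),
      mvfderiv (𝓡∂ (n + 1)) (r j) x (v x) = r (j + 1) x)
    (hj : j ≤ n) (hx : x ∈ boundaryStratum n Y (j + 1)) :
    v x ∈ tangentSub (𝓡∂ (n + 1)) (boundaryStratum n Y (j + 1)) x ↔
      x ∈ boundaryStratum n Y (j + 2) := by
  rw [h.mem_tangentSub_stratum_iff hj hx, mem_jointKer_succ, hvr j hj x hx,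
    h.mem_stratum_succ (j := j + 1) (by omega)]
  exact ⟨fun hw => ⟨hx, hw.2⟩, fun hw => ⟨h.mem_jointKer_of_mem_stratum hvr (by omega) hx, hw.2⟩⟩

theorem morseStratum_eq (h : IsDefiningTower n Y r)
    (hC1 : boundaryStratum n Y 1 = (𝓡∂ (n + 1)).boundary X)
    (hvr : ∀ j ≤ n, ∀ x ∈ boundaryStratum n Y (j + 1),
      mvfderiv (𝓡∂ (n + 1)) (r j) x (v x) = r (j + 1) x) :
    ∀ j ≤ n + 1, morseStratum v j = boundaryStratum n Y j
  | 0, _ => rfl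
  | 1, _ => hC1.symm
  | j + 2, hj => by
    have ih := morseStratum_eq h hC1 hvr (j + 1) (by omega)
    ext x
    change x ∈ morseStratum v (j + 1) ∧
      v x ∈ tangentSub (𝓡∂ (n + 1)) (morseStratum v (j + 1)) x ↔ _
    rw [ih]
    refine ⟨fun hx => (h.mem_tangentSub_iff_mem_stratum hvr (by omega) hx.1).1 hx.2, fun hx => ?_⟩
    have hx' := h.stratum_succ_subset (by omega) hx
    exact ⟨hx', (h.mem_tangentSub_iff_mem_stratum hvr (by omega) hx').2 hx⟩

theorem morseStratumPlus_eq (h : IsDefiningTower n Y r) (hY0 : Y 0 = univ)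
    (hC1 : boundaryStratum n Y 1 = (𝓡∂ (n + 1)).boundary X)
    (hvr : ∀ j ≤ n, ∀ x ∈ boundaryStratum n Y (j + 1),
      mvfderiv (𝓡∂ (n + 1)) (r j) x (v x) = r (j + 1) x) :
    ∀ j ≤ n + 1, morseStratumPlus v j = Y j
  | 0, _ => hY0.symm
  | j + 1, hj => by
    have ih := morseStratumPlus_eq h hY0 hC1 hvr j (by omega)
    ext x
    change x ∈ morseStratum v (j + 1) ∧
      v x ∈ tangentCone (𝓡∂ (n + 1)) (morseStratumPlus v j) x ↔ _
    rw [ih, h.morseStratum_eq hC1 hvr (j + 1) hj]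
    have key : ∀ hx : x ∈ boundaryStratum n Y (j + 1),
        v x ∈ tangentCone (𝓡∂ (n + 1)) (Y j) x ↔ x ∈ Y (j + 1) := fun hx => by
      rw [h.mem_tangentCone_iff (by omega) hx, hvr j (by omega) x hx,
        (h.defining (j + 1) hj).nonneg_iff x hx]
      exact ⟨fun hw => hw.2, fun hw => ⟨h.mem_jointKer_of_mem_stratum hvr (by omega) hx, hw⟩⟩
    exact ⟨fun hx => (key hx.1).1 hx.2,
      fun hx => ⟨h.subset _ hj hx, (key (h.subset _ hj hx)).2 hx⟩⟩

/-- The defining function `r j` trivializes the normal line bundle of `∂ (Y j)`; the derivative of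
`v` in this trivialization is `dr_{j+1}` since `dr_j(v) = r_{j+1}` on `∂ (Y j)`. -/
theorem normalTransversal [IsManifold (𝓡∂ (n + 1)) ∞ X] (h : IsDefiningTower n Y r)
    (hv : IsSmoothField v)
    (hvr : ∀ j ≤ n, ∀ x ∈ boundaryStratum n Y (j + 1),
      mvfderiv (𝓡∂ (n + 1)) (r j) x (v x) = r (j + 1) x) (hj : j ≤ n) :
    NormalTransversal (boundaryStratum n Y j) (boundaryStratum n Y (j + 1)) v := by
  intro x hx hvx
  have hx' := (h.mem_tangentSub_iff_mem_stratum hvr hj hx).1 hvx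
  obtain ⟨w, hw, -, hw0⟩ := h.exists_mem_jointKer_pos (by omega) hx
  obtain ⟨u, hu, -, hu0⟩ := h.exists_mem_jointKer_pos (by omega) hx'
  have hu' := tangentCone_mono (h.subset (j + 1) (by omega)) hu
  refine ⟨univ, r j, isOpen_univ, mem_univ x, (h.defining j (by omega)).smooth.contMDiffOn,
    fun y hy => ((h.mem_stratum_succ (by omega)).1 hy.1).2,
    ⟨w, Submodule.subset_span (tangentCone_mono (h.subset j (by omega)) hw), hw0.ne'⟩,
    u, Submodule.subset_span hu', ?_⟩
  have hd1 : MDifferentiableAt (𝓡∂ (n + 1)) 𝓘(ℝ, ℝ)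
      (fun y => mvfderiv (𝓡∂ (n + 1)) (r j) y (v y)) x :=
    (contMDiffAt_mvfderiv_apply (h.defining j (by omega)).smooth
      hv.contMDiffAt).mdifferentiableAt (by simp)
  have hd2 := h.mdifferentiableAt (j := j + 1) (by omega) x
  have h0 := mvfderiv_eq_zero_of_mem_tangentCone hu' (hd1.sub hd2) <| by
    filter_upwards [self_mem_nhdsWithin] with y hy
    change mvfderiv (𝓡∂ (n + 1)) (r j) y (v y) - r (j + 1) y =
      mvfderiv (𝓡∂ (n + 1)) (r j) x (v x) - r (j + 1) x
    rw [hvr j hj y hy, hvr j hj x hx, sub_self, sub_self]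
  -- the derivative of `dr_j(v)` along `u` is that of `r_{j+1}`, which is positive
  rw [mvfderiv_sub hd1 hd2] at h0
  exact fun h1 => hu0.ne' ((sub_eq_zero.1 h0).symm.trans h1)

theorem isBoundaryGeneric [IsManifold (𝓡∂ (n + 1)) ∞ X] (h : IsDefiningTower n Y r)
    (hC1 : boundaryStratum n Y 1 = (𝓡∂ (n + 1)).boundary X) (hv : IsSmoothField v)
    (hv0 : ∀ x ∈ (𝓡∂ (n + 1)).boundary X, v x ≠ 0) (hvt : TransversalToZero v)
    (hvr : ∀ j ≤ n, ∀ x ∈ boundaryStratum n Y (j + 1),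
      mvfderiv (𝓡∂ (n + 1)) (r j) x (v x) = r (j + 1) x) : IsBoundaryGeneric v where
  smooth := hv
  ne_zero := hv0
  transversal := hvt
  submanifold j hj hj' := by
    obtain ⟨j, rfl⟩ := Nat.exists_eq_add_of_le' hj
    rw [h.morseStratum_eq hC1 hvr _ hj']
    exact ⟨isSubmanifold_subBoundary, subBoundary_subBoundary⟩
  normal_transversal j hj hj' := by
    obtain ⟨j, rfl⟩ := Nat.exists_eq_add_of_le' hj
    rw [h.morseStratum_eq hC1 hvr _ hj', h.morseStratum_eq hC1 hvr _ (by omega)]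
    exact h.normalTransversal hv hvr (by omega)

end IsDefiningTower

end Verification

/-! ### Deformation of gradient-like fields -/

section GradientLike

variable {E : Type*} [NormedAddCommGroup E] [NormedSpace ℝ E]
  {H : Type*} [TopologicalSpace H] {I : ModelWithCorners ℝ E H}
  {X : Type*} [TopologicalSpace X] [ChartedSpace H X] [IsManifold I ∞ X]
  {f : X → ℝ} {v v' : ∀ x : X, TangentSpace I x}

/-- A smooth field which agrees with a gradient-like field near the critical points and increases
the function elsewhere is gradient-like. -/
theorem IsGradientLike.of_eqOn (hv : IsGradientLike f v) (hs : IsSmoothField v')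
    (hpos : ∀ x, mvfderiv I f x ≠ 0 → 0 < mvfderiv I f x (v' x)) {N : Set X} (hN : IsOpen N)
    (hZN : ∀ x, mvfderiv I f x = 0 → x ∈ N) (hvv' : ∀ x ∈ N, v' x = v x) :
    IsGradientLike f v' := by
  have hz : ∀ x, v' x = 0 ↔ mvfderiv I f x = 0 := fun x => by
    refine ⟨fun h0 => by_contra fun hx => ?_, fun hx => ?_⟩
    · have := hpos x hx
      rw [h0, map_zero] at this
      exact this.false
    · rw [hvv' x (hZN x hx)]
      exact (hv.zero_iff x).2 hx
  refine ⟨hs, hz, fun x hx => hpos x fun h0 => hx ((hz x).2 h0), ?_⟩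
  obtain ⟨g, U, hU, hZU, hg⟩ := hv.gradient
  refine ⟨g, U ∩ N, hU.inter hN, fun x hx => ⟨hZU x hx, hZN x hx⟩, fun x hx w => ?_⟩
  rw [hvv' x hx.2]
  exact hg x hx.1 w

/-- The linear homotopy between two gradient-like fields which agree near the critical points. -/
theorem IsGradientLike.deformation (hv : IsGradientLike f v) (hv' : IsGradientLike f v')
    {N : Set X} (hN : IsOpen N) (hZN : ∀ x, mvfderiv I f x = 0 → x ∈ N)
    (hvv' : ∀ x ∈ N, v' x = v x) : GradientLikeDeformation f v v' := by
  refine ⟨fun t x => (1 - t) • v x + t • v' x, ?_, fun t ht => ?_, ?_, ?_⟩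
  · have hsec : ∀ u : (∀ x : X, TangentSpace I x), IsSmoothField u → ∀ p : ℝ × X,
        ContMDiffAt (𝓘(ℝ, ℝ).prod I) 𝓘(ℝ, E) ∞
          (fun q : ℝ × X => (trivializationAt E (TangentSpace I) p.2 ⟨q.2, u q.2⟩).2) p := by
      intro u hu p
      have h1 := (hu.comp (contMDiff_snd (I := 𝓘(ℝ, ℝ)) (M := ℝ))).contMDiffAt (x := p)
      exact (Bundle.contMDiffAt_totalSpace.1 h1).2
    refine ContMDiff.contMDiffOn fun p => ?_
    refine Bundle.contMDiffAt_totalSpace.2 ⟨contMDiffAt_snd, ?_⟩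
    have h1 := ((contMDiffAt_const (c := (1:ℝ))).sub
      (contMDiffAt_fst (I := 𝓘(ℝ, ℝ)) (J := I) (n := ∞) (p := p))).smul (hsec v hv.smooth p)
    have h2 := (contMDiffAt_fst (I := 𝓘(ℝ, ℝ)) (J := I) (n := ∞) (p := p)).smul
      (hsec v' hv'.smooth p)
    refine (h1.add h2).congr_of_eventuallyEq ?_
    set e := trivializationAt E (TangentSpace I) p.2
    have hbase : ∀ᶠ q : ℝ × X in 𝓝 p, q.2 ∈ e.baseSet :=
      continuous_snd.continuousAt.eventually
        (e.open_baseSet.mem_nhds (FiberBundle.mem_baseSet_trivializationAt' p.2))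
    filter_upwards [hbase] with q hq
    have hlin := e.linear ℝ hq
    change (e ⟨q.2, (1 - q.1) • v q.2 + q.1 • v' q.2⟩).2 =
      (1 - q.1) • (e ⟨q.2, v q.2⟩).2 + q.1 • (e ⟨q.2, v' q.2⟩).2
    rw [hlin.1, hlin.2, hlin.2]
  · refine hv.of_eqOn ?_ (fun x hx => ?_) hN hZN fun x hx => ?_
    · have h1 := (ContMDiff.const_smul_section (a := 1 - t) hv.smooth).add_section
        (ContMDiff.const_smul_section (a := t) hv'.smooth)
      exact h1
    · rw [map_add, map_smul, map_smul]
      exact (convex_Ioi (0:ℝ)) (hv.pos x fun h0 => hx ((hv.zero_iff x).1 h0))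
        (hv'.pos x fun h0 => hx ((hv'.zero_iff x).1 h0)) (by linarith [ht.2]) ht.1 (by ring)
    · change (1 - t) • v x + t • v' x = v x
      rw [hvv' x hx, ← add_smul]
      simp
  · ext x; simp
  · ext x; simp

end GradientLike

/-! ### Transversality of a gradient-like field at its zeros -/

section Hessian

variable {E : Type*} [NormedAddCommGroup E] [NormedSpace ℝ E]
  {H : Type*} [TopologicalSpace H] {I : ModelWithCorners ℝ E H}
  {X : Type*} [TopologicalSpace X] [ChartedSpace H X] [IsManifold I ∞ X] {f : X → ℝ}

/-- A field with constant coordinates in the trivialization at `x` is smooth near `x`. -/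
theorem contMDiffAt_symmL (x : X) (a : E) :
    ContMDiffAt I I.tangent ∞ (fun y => (⟨y, (trivializationAt E (TangentSpace I) x).symmL ℝ y a⟩ :
      TangentBundle I X)) x := by
  rw [contMDiffAt_section]
  set e := trivializationAt E (TangentSpace I : X → Type _) x
  refine (contMDiffAt_const (c := a)).congr_of_eventuallyEq ?_
  filter_upwards [e.open_baseSet.mem_nhds (FiberBundle.mem_baseSet_trivializationAt' x)] with y hy
  rw [e.symmL_apply hy, e.apply_mk_symm hy]

/-- The derivative of `f` along a coordinate field is the partial derivative of `f` in the chart. -/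
theorem mvfderiv_symmL (hf : ContMDiff I 𝓘(ℝ, ℝ) ∞ f) {x y : X} (hy : y ∈ (chartAt H x).source)
    (a : E) :
    mvfderiv I f y ((trivializationAt E (TangentSpace I) x).symmL ℝ y a) =
      fderivWithin ℝ (f ∘ (extChartAt I x).symm) (range I) (extChartAt I x y) a := by
  have hy' : y ∈ (extChartAt I x).source := by rwa [extChartAt_source]
  rw [TangentBundle.symmL_trivializationAt hy]
  have h := mvfderiv_comp_mfderivWithin_of_eq (s := range I) (x := extChartAt I x y)
    (f := (extChartAt I x).symm) (y := y) (g := f) (hf.mdifferentiable (by simp) y)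
    (mdifferentiableWithinAt_extChartAt_symm ((extChartAt I x).map_source hy'))
    (I.uniqueDiffOn.uniqueDiffWithinAt
      (extChartAt_target_subset_range x ((extChartAt I x).map_source hy'))).uniqueMDiffWithinAt
    ((extChartAt I x).left_inv hy')
  have h1 : fderivWithin ℝ (f ∘ (extChartAt I x).symm) (range I) (extChartAt I x y) =
      mvfderivWithin 𝓘(ℝ, E) (f ∘ (extChartAt I x).symm) (range I) (extChartAt I x y) := by
    ext b
    simp only [mvfderivWithin, mfderivWithin_eq_fderivWithin]
    rfl
  rw [h1, h]
  rfl

theorem contMDiffAt_inner_symmL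
    (g : ContMDiffRiemannianMetric I ∞ E (fun x : X => TangentSpace I x))
    (x : X) (a b : E) :
    ContMDiffAt I 𝓘(ℝ, ℝ) ∞ (fun y => g.inner y
      ((trivializationAt E (TangentSpace I) x).symmL ℝ y a)
      ((trivializationAt E (TangentSpace I) x).symmL ℝ y b)) x := by
  have : ContMDiffAt I (I.prod 𝓘(ℝ)) ∞
      (fun y => TotalSpace.mk' ℝ (E := Bundle.Trivial X ℝ) y (g.inner y
        ((trivializationAt E (TangentSpace I) x).symmL ℝ y a)
        ((trivializationAt E (TangentSpace I) x).symmL ℝ y b))) x := by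
    apply ContMDiffAt.clm_bundle_apply₂ (F₁ := E) (F₂ := E)
    · exact g.contMDiff.contMDiffAt
    · exact contMDiffAt_symmL x a
    · exact contMDiffAt_symmL x b
  exact (Bundle.contMDiffAt_totalSpace.1 this).2

/-- At a zero of a gradient-like field, the kernel of the derivative of the field lies in the kernel
of the Hessian: differentiate `df(A) = g(v, A)` for coordinate fields `A`, writing `v` as a
combination of coordinate fields whose coefficients vanish at the zero. -/
theorem IsGradientLike.hessian_eq_zero [FiniteDimensional ℝ E] (hf : ContMDiff I 𝓘(ℝ, ℝ) ∞ f)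
    {v : ∀ x : X, TangentSpace I x} (hv : IsGradientLike f v) {x : X} (hx : v x = 0)
    {w : E}
    (hw : (mvfderiv I (fun y => (trivializationAt E (TangentSpace I : X → Type _) x
      (⟨y, v y⟩ : TangentBundle I X)).2) x : E →L[ℝ] E) w = 0) :
    fderivWithin ℝ (fderivWithin ℝ (f ∘ (extChartAt I x).symm) (range I)) (range I)
      (extChartAt I x x) w = 0 := by
  obtain ⟨g, U, hU, hZU, hg⟩ := hv.gradient
  have hxU := hZU x ((hv.zero_iff x).1 hx)
  set e := trivializationAt E (TangentSpace I : X → Type _) x with he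
  set φ := extChartAt I x with hφ
  set u := φ x with hu
  have huI : u ∈ range I := mem_range_self _
  have hud : UniqueDiffWithinAt ℝ (range I) u := I.uniqueDiffOn u huI
  have hbase : ∀ y ∈ (chartAt H x).source, y ∈ e.baseSet := fun y hy => by
    rwa [he, TangentBundle.trivializationAt_baseSet]
  set vt : X → E := fun y => (e (⟨y, v y⟩ : TangentBundle I X)).2 with hvt
  have hvtx : vt x = 0 := by
    have := (e.linear ℝ (FiberBundle.mem_baseSet_trivializationAt' x)).map_zero
    simpa only [hvt, hx] using this
  have hvtd : MDifferentiableAt I 𝓘(ℝ, E) vt x :=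
    ((Bundle.contMDiffAt_totalSpace.1 (hv.smooth x)).2).mdifferentiableAt (by simp)
  obtain ⟨V, hVw, hVd⟩ : ∃ V : E →L[ℝ] E, V w = 0 ∧
      HasFDerivWithinAt (vt ∘ φ.symm) V (range I) u :=
    ⟨mvfderiv I vt x, hw, hvtd.hasMFDerivAt.2⟩
  set F' := fderivWithin ℝ (f ∘ φ.symm) (range I) with hF'
  have hF'd : DifferentiableWithinAt ℝ F' (range I) u := by
    have h1 : ContDiffWithinAt ℝ ∞ (f ∘ φ.symm) (range I) u := (contMDiffAt_iff.1 (hf x)).2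
    exact (h1.fderivWithin_right I.uniqueDiffOn (m := ∞) (by simp) huI).differentiableWithinAt
      (by simp)
  set b := Module.finBasis ℝ E with hb
  ext a
  -- the derivative of `f` along the coordinate field of `a`, in two ways
  have hev : ∀ᶠ z in 𝓝[range I] u, F' z a =
      ∑ i, b.repr (vt (φ.symm z)) i * g.inner (φ.symm z) (e.symmL ℝ (φ.symm z) (b i))
        (e.symmL ℝ (φ.symm z) a) := by
    have hcont : Tendsto φ.symm (𝓝[range I] u) (𝓝 x) := by
      have := continuousAt_extChartAt_symm (I := I) x
      rw [ContinuousAt, extChartAt_to_inv] at this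
      exact this.mono_left nhdsWithin_le_nhds
    filter_upwards [extChartAt_target_mem_nhdsWithin (I := I) x, hcont.eventually (hU.mem_nhds hxU)]
      with z hz hzU
    have hys : φ.symm z ∈ (chartAt H x).source := by
      rw [← extChartAt_source (I := I)]
      exact φ.map_target hz
    have h1 := mvfderiv_symmL hf hys a
    rw [← hφ, φ.right_inv hz] at h1
    rw [hF', ← h1, ← hg _ hzU]
    have h2 : v (φ.symm z) = e.symmL ℝ (φ.symm z) (∑ i, b.repr (vt (φ.symm z)) i • b i) := by
      rw [b.sum_repr, e.symmL_apply (hbase _ hys), hvt]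
      exact (e.symm_apply_apply_mk (hbase _ hys) _).symm
    rw [h2]
    simp only [map_sum, map_smul, sum_apply, smul_apply, smul_eq_mul, he]
  have hG : ∀ i, ∃ G' : E →L[ℝ] ℝ, HasFDerivWithinAt (fun z => g.inner (φ.symm z)
      (e.symmL ℝ (φ.symm z) (b i)) (e.symmL ℝ (φ.symm z) a)) G' (range I) u := fun i =>
    ⟨_, ((contMDiffAt_inner_symmL g x (b i) a).mdifferentiableAt (by simp)).hasMFDerivAt.2⟩
  choose G' hG' using hG
  have hux : φ.symm u = x := extChartAt_to_inv x
  have hterm : ∀ i, ∃ Q : E →L[ℝ] ℝ, HasFDerivWithinAt (fun z => b.repr (vt (φ.symm z)) i *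
      g.inner (φ.symm z) (e.symmL ℝ (φ.symm z) (b i)) (e.symmL ℝ (φ.symm z) a)) Q (range I) u ∧
      Q w = 0 := by
    intro i
    refine ⟨_, ((b.coord i).toContinuousLinearMap.hasFDerivAt.comp_hasFDerivWithinAt u hVd).mul
      (hG' i), ?_⟩
    simp [hux, hvtx, hVw]
  choose Q hQ hQw using hterm
  have hsum : HasFDerivWithinAt (fun z => F' z a) (∑ i, Q i) (range I) u :=
    (HasFDerivWithinAt.fun_sum fun i _ => hQ i).congr_of_eventuallyEq hev
      (hev.self_of_nhdsWithin huI)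
  have hF'a := (ContinuousLinearMap.apply ℝ ℝ a).hasFDerivAt.comp_hasFDerivWithinAt u
    hF'd.hasFDerivWithinAt
  have h3 := DFunLike.congr_fun (hud.eq hF'a hsum) w
  refine h3.trans ?_
  rw [sum_apply]
  exact Finset.sum_eq_zero fun i _ => hQw i

end Hessian

/-- At a zero the derivative of a gradient-like field of a Morse function is injective, by
`IsGradientLike.hessian_eq_zero` and the nondegeneracy of the Hessian, hence bijective. -/
theorem IsGradientLike.transversalToZero {n : ℕ} {X : Type*} [TopologicalSpace X]
    [ChartedSpace (EuclideanHalfSpace (n + 1)) X] [IsManifold (𝓡∂ (n + 1)) ∞ X] {f : X → ℝ}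
    (hf : ContMDiff (𝓡∂ (n + 1)) 𝓘(ℝ, ℝ) ∞ f)
    (hM : IsMorseOn (𝓡∂ (n + 1)) (n + 1) f univ) {v : ∀ x : X, TangentSpace (𝓡∂ (n + 1)) x}
    (hv : IsGradientLike f v) : TransversalToZero v := by
  intro x hx
  have hp := isLocalParam_extChartAt (n := n) x
  have hmem := hp.mapsTo_ψ ⟨mem_univ x, mem_extChartAt_source x⟩
  have hcrit : fderivWithin ℝ (f ∘ (extChartAt (𝓡∂ (n + 1)) x).symm) (halfSpace (n + 1))
      (extChartAt (𝓡∂ (n + 1)) x x) = 0 := by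
    ext a
    rw [halfSpace_eq_range, ← mvfderiv_symmL hf (mem_chart_source _ x), (hv.zero_iff x).1 hx]
    rfl
  have hbij := hM _ _ _ _ hp _ hmem hcrit
  rw [halfSpace_eq_range] at hbij
  set L : EuclideanSpace ℝ (Fin (n + 1)) →ₗ[ℝ] EuclideanSpace ℝ (Fin (n + 1)) :=
    (mvfderiv (𝓡∂ (n + 1)) (fun y => (trivializationAt (EuclideanSpace ℝ (Fin (n + 1)))
      (TangentSpace (𝓡∂ (n + 1)) : X → Type _) x
      (⟨y, v y⟩ : TangentBundle (𝓡∂ (n + 1)) X)).2) x).toLinearMap with hL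
  have hinj : Function.Injective L := by
    rw [← LinearMap.ker_eq_bot, LinearMap.ker_eq_bot']
    intro w hw
    refine hbij.1 ?_
    rw [map_zero]
    exact hv.hessian_eq_zero hf hx hw
  exact ⟨hinj, LinearMap.injective_iff_surjective.1 hinj⟩

/-! ### Existence of the deformation -/

theorem theorem3p2 {n : ℕ} {X : Type*} [TopologicalSpace X] [T2Space X] [CompactSpace X]
    [ChartedSpace (EuclideanHalfSpace (n + 1)) X] [IsManifold (𝓡∂ (n + 1)) ∞ X]
    (hX : ((𝓡∂ (n + 1)).boundary X).Nonempty)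
    (f : X → ℝ) (hf : ContMDiff (𝓡∂ (n + 1)) 𝓘(ℝ, ℝ) ∞ f)
    (hfb : ∀ x ∈ (𝓡∂ (n + 1)).boundary X, mvfderiv (𝓡∂ (n + 1)) f x ≠ 0)
    (v : ∀ x : X, TangentSpace (𝓡∂ (n + 1)) x) (hv : IsGradientLike f v)
    -- the stratification `X = Y 0 ⊇ Y 1 ⊇ ... ⊇ Y (n + 1)`
    (Y : ℕ → Set X) (hY0 : Y 0 = univ)
    (hYc : ∀ j ≤ n + 1, IsCompact (Y j))
    (hYm : ∀ j ≤ n + 1, IsSubmanifold (𝓡∂ (n + 1)) (n + 1 - j) (Y j))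
    (hY1 : Y 1 ⊆ (𝓡∂ (n + 1)).boundary X)
    (hYs : ∀ j, 2 ≤ j → j ≤ n + 1 →
      Y j ⊆ subBoundary (𝓡∂ (n + 1)) (n + 1 - (j - 1)) (Y (j - 1)))
    -- Morse conditions on `Y j` and `∂ (Y j)`
    (hM : ∀ j ≤ n + 1, IsMorseOn (𝓡∂ (n + 1)) (n + 1 - j) f (Y j))
    (hMb : ∀ j ≤ n + 1, IsMorseOn (𝓡∂ (n + 1)) (n + 1 - j - 1) f
      (subBoundary (𝓡∂ (n + 1)) (n + 1 - j) (Y j)))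
    -- sign conditions
    (hpos : ∀ j, 1 ≤ j → j ≤ n + 1 → ∀ x ∈ critSet (𝓡∂ (n + 1)) f (Y j),
      ∀ ν : TangentSpace (𝓡∂ (n + 1)) x,
        PointsInto (𝓡∂ (n + 1)) (n + 1 - (j - 1)) (Y (j - 1)) x ν →
          0 < mvfderiv (𝓡∂ (n + 1)) f x ν)
    (hneg : ∀ j, 1 ≤ j → j ≤ n + 1 →
      ∀ x ∈ critSet (𝓡∂ (n + 1)) f
          (subBoundary (𝓡∂ (n + 1)) (n + 1 - (j - 1)) (Y (j - 1))) \
          critSet (𝓡∂ (n + 1)) f (Y j),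
      ∀ ν : TangentSpace (𝓡∂ (n + 1)) x,
        PointsInto (𝓡∂ (n + 1)) (n + 1 - (j - 1)) (Y (j - 1)) x ν →
          mvfderiv (𝓡∂ (n + 1)) f x ν < 0) :
    ∃ v' : ∀ x : X, TangentSpace (𝓡∂ (n + 1)) x,
      GradientLikeDeformation f v v' ∧ IsGradientLike f v' ∧ IsBoundaryGeneric v' ∧
        ∀ j ≤ n + 1, morseStratumPlus v' j = Y j := by
  have hC1 : boundaryStratum n Y 1 = (𝓡∂ (n + 1)).boundary X := by
    change subBoundary (𝓡∂ (n + 1)) (n + 1) (Y 0) = _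
    rw [hY0, subBoundary_univ]
  have hsub : ∀ j ≤ n + 1, Y j ⊆ boundaryStratum n Y j
    | 0, _ => subset_univ _
    | 1, _ => hC1 ▸ hY1
    | j + 2, hj => hYs (j + 2) (by omega) hj
  choose! r hr using fun j (hj : j ≤ n + 1) =>
    exists_isDefiningFunction_boundaryStratum hY0 (fun j hj => (hYc j hj).isClosed) hYm hsub hj
  have h : IsDefiningTower n Y r := ⟨hsub, hr⟩
  obtain ⟨v', hs, hdf, ⟨N, hN, hZN, hvv'⟩, hvr⟩ := h.exists_adapted_field hf
    (fun x hx => hfb x (hC1 ▸ hx)) hv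
    fun p hp x hx hx' => h.exists_vector hpos hneg hp hx hx'
  have hv' := hv.of_eqOn hs hdf hN hZN hvv'
  refine ⟨v', hv.deformation hv' hN hZN hvv', hv', ?_, h.morseStratumPlus_eq hY0 hC1 hvr⟩
  exact h.isBoundaryGeneric hC1 hs (fun x hx h0 => hfb x hx ((hv'.zero_iff x).1 h0))
    (hv'.transversalToZero hf (hY0 ▸ hM 0 (Nat.zero_le _))) hvr
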